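/- Let $K,L,q\in\mathbb N$ with $q>2$ and let $0<h<1$ be such that $2/h$ is not an integer; put $\ell^*:=\lceil 2/h\rceil$ and assume $K,L\ge 3\ell^*$. Let $\Lambda=(V,E)$ be the $K\times L$ grid with periodic boundary conditions (the discrete torus), let $\mathcal X=\{1,\dots,q\}^V$, and for $\sigma\in\mathcal X$ let $$H(\sigma)=-\sum_{(v,w)\in E}\mathbb 1_{\{\sigma(v)=\sigma(w)\}}-h\sum_{v\in V}\mathbb 1_{\{\sigma(v)=1\}}.$$ For a spin value $s$ let $\mathbf s\in\mathcal X$ be the configuration with all spins equal to $s$. A path from $\sigma$ to $\sigma'$ is a finite sequence of configurations $\omega=(\omega_0=\sigma,\dots,\omega_n=\sigma')$ in which consecutive configurations differ at exactly one vertex; let $\Phi(\sigma,\sigma')$ be the minimum over these paths of $\max_{\eta\in\omega}H(\eta)$; a path is optimal if it attains this minimum, and $\mathcal S(\sigma,\sigma')$ is the set of the configurations of energy $\Phi(\sigma,\sigma')$ that lie on an optimal path. A gate for the transition $\sigma\to\sigma'$ is a set $\mathcal W\subseteq\mathcal S(\sigma,\sigma')$ that meets every optimal path from $\sigma$ to $\sigma'$;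 it is minimal if each proper subset of it is avoided by some optimal path. A configuration is stable if it is a global minimum of $H$. The stability level of $\sigma$ is $V_\sigma=\min\{\Phi(\sigma,\eta):H(\eta)<H(\sigma)\}-H(\sigma)$ (with $V_\sigma=\infty$ if there is no such $\eta$), and $\eta$ is metastable if $V_\eta$ equals the maximum of $V_\sigma$ over all $\sigma$ that are not stable. Then $\mathbf 1$ is the only stable configuration, the metastable configurations are exactly $\mathbf 2,\dots,\mathbf q$, and for every $m\in\{2,\dots,q\}$ the following holds. Let $\mathcal W(m)=\bar B^1_{\ell^*-1,\ell^*}(m,1)$ be the set of the configurations in which all spins are $m$, except those, equal to $1$, in a rectangle of side lengths $\ell^*-1$ and $\ell^*$ (in either orientation) with a single additional vertex adjacent to one of the two sides of length $\ell^*$ (at any position along this side). Then $\mathcal W(m)$ is a minimal gate for the transition $\mathbf m\to\mathbf 1$, and $\mathcal W(m)$ is the union of all minimal gates for this transition. -/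

import Mathlib

noncomputable section

/-! ### Energy landscapes

A landscape is a state space `X` with an energy `H : X → ℝ` and the graph `G` of the pairs of
distinct states between which the dynamics can move in one step. A path is a walk in `G`. -/

namespace Landscape

variable {X : Type*} (G : SimpleGraph X) (H : X → ℝ)

/-- The height of a path: the maximal energy of the states that it visits. -/
def height {G : SimpleGraph X} {x y : X} (p : G.Walk x y) : ℝ :=
  sSup (H '' {z | z ∈ p.support})

/-- The communication height `Φ(x, y)`: the minimal height of a path from `x` to `y`. -/
def commHeight (x y : X) : ℝ :=
  sInf (Set.range fun p : G.Walk x y => height H p)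

/-- The communication height `Φ(x, A)` between a state and a (non-empty) set of states. -/
def commHeightSet (x : X) (A : Set X) : ℝ :=
  sInf (commHeight G H x '' A)

/-- The optimal paths from `x` to `y`: those of minimal height. -/
def IsOptimal {G : SimpleGraph X} {x y : X} (p : G.Walk x y) : Prop :=
  height H p = commHeight G H x y

/-- The states of energy strictly smaller than that of `x`. -/
def lower (x : X) : Set X := {z | H z < H x}

open Classical in
/-- The stability level `V_x = Φ(x, I_x) - H(x)`, where `I_x` is the set of the states of energy
smaller than `H(x)`; it is `∞` if there is no such state. -/
def stabilityLevel (x : X) : WithTop ℝ :=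
  if (lower H x).Nonempty then ((commHeightSet G H x (lower H x) - H x : ℝ) : WithTop ℝ) else ⊤

/-- The stable states: the global minima of the energy. -/
def stable : Set X := {x | ∀ z, H x ≤ H z}

/-- The metastable states: those whose stability level is the maximum of the stability levels of
the states that are not stable. -/
def metastable : Set X :=
  {x | IsGreatest (stabilityLevel G H '' (stable H)ᶜ) (stabilityLevel G H x)}

/-- The minimal saddles between `x` and `y`: the states of maximal energy on an optimal path. -/
def saddles (x y : X) : Set X :=
  {z | ∃ p : G.Walk x y, IsOptimal H p ∧ z ∈ p.support ∧ H z = height H p}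

/-- A gate for the transition from `x` to `y`: a set of minimal saddles that meets every optimal
path. -/
def IsGate (x y : X) (W : Set X) : Prop :=
  W ⊆ saddles G H x y ∧
    ∀ p : G.Walk x y, IsOptimal H p → ∃ z ∈ p.support, z ∈ W

/-- A minimal gate: a gate such that each proper subset of it is avoided by an optimal path. -/
def IsMinimalGate (x y : X) (W : Set X) : Prop :=
  IsGate G H x y W ∧
    ∀ W' : Set X, W' ⊂ W → ∃ p : G.Walk x y, IsOptimal H p ∧ ∀ z ∈ p.support, z ∉ W'

/-- The union of all the minimal gates for the transition from `x` to `y`. -/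
def gateUnion (x y : X) : Set X :=
  {z | ∃ W : Set X, IsMinimalGate G H x y W ∧ z ∈ W}

end Landscape

/-! ### The Potts model on the torus -/

namespace Potts

/-- The vertices of the `K × L` torus; the coordinates are the row and the column. -/
abbrev Site (K L : ℕ) : Type := ZMod K × ZMod L

/-- The spin configurations. The spin values `1, …, q` are represented by the elements
`0, …, q - 1` of `Fin q`. -/
abbrev Config (K L q : ℕ) : Type := Site K L → Fin q

/-- The spin value favoured by the external field, called `1` in the text. -/
abbrev one {q : ℕ} [NeZero q] : Fin q := 0

variable {K L q : ℕ}

/-- The configuration in which all the spins are equal to `s`. -/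
def const (s : Fin q) : Config K L q := fun _ => s

/-- The Potts Hamiltonian with coupling constant `1` and external field `h` on the spin value
`one`. For `3 ≤ K` and `3 ≤ L`, each edge of the torus joins exactly one vertex to its successor in
the same column or in the same row, so that the first sum runs once over each edge. -/
def energy [NeZero K] [NeZero L] [NeZero q] (h : ℝ) (σ : Config K L q) : ℝ :=
  -(∑ v : Site K L, ((if σ v = σ (v + (1, 0)) then (1 : ℝ) else 0)
      + (if σ v = σ (v + (0, 1)) then (1 : ℝ) else 0)))
    - h * ∑ v : Site K L, (if σ v = one then (1 : ℝ) else 0)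

/-- The single-spin-flip graph: two configurations are adjacent if they differ at exactly one
vertex, that is, if the connectivity matrix `Q` of the Metropolis dynamics is positive on them. -/
def flipGraph (K L q : ℕ) [NeZero K] [NeZero L] : SimpleGraph (Config K L q) where
  Adj σ τ := hammingDist σ τ = 1
  symm := ⟨fun σ τ hst => by rw [hammingDist_comm]; exact hst⟩
  loopless := ⟨fun σ hs => by simp at hs⟩

/-- The rectangle with `a` rows and `b` columns whose first vertex is `p`. -/
def rect (p : Site K L) (a b : ℕ) : Set (Site K L) :=
  {v | ∃ i < a, ∃ j < b, v = p + ((i : ZMod K), (j : ZMod L))}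

/-- `D` is the union of a rectangle `a × b`, in one of its two orientations, and of a bar `1 × l`
adjacent to one of its two sides of length `b`, at any position `k` along this side. -/
def IsRectWithBar (a b l : ℕ) (D : Set (Site K L)) : Prop :=
  ∃ (p : Site K L) (k : ℕ), k + l ≤ b ∧
    (D = rect p a b ∪ rect (p + (-1, (k : ZMod L))) 1 l ∨
     D = rect p a b ∪ rect (p + ((a : ZMod K), (k : ZMod L))) 1 l ∨
     D = rect p b a ∪ rect (p + ((k : ZMod K), -1)) l 1 ∨
     D = rect p b a ∪ rect (p + ((k : ZMod K), (a : ZMod L))) l 1)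

/-- The set `B̄ˡ_{a,b}(r, s)` (for `1 ≤ l ≤ b - 1`): all the spins are `r`, except those in a
rectangle `a × b` with a bar `1 × l` adjacent to one of the sides of length `b`, which are `s`. -/
def barB (a b l : ℕ) (r s : Fin q) : Set (Config K L q) :=
  {σ | ∃ D : Set (Site K L), IsRectWithBar a b l D ∧
    (∀ v ∈ D, σ v = s) ∧ (∀ v ∉ D, σ v = r)}

/-- The critical length `ℓ* = ⌈2 / h⌉`. -/
def critLen (h : ℝ) : ℕ := ⌈2 / h⌉₊

end Potts

end

/-!
Relative to a constant configuration `m ≠ one`, a configuration has the energy (`excess`)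
`#(disagreeing edges) - h * #(spins one)`. Write `l` for the critical length, so that
`h * (l - 1) < 2 < h * l`, and `barrier h l = 4 * l - h * (l * (l - 1) + 1)`.

*Every path crosses a critical droplet.* If some row and some column are constantly `m`, let `r` and
`c` be the numbers of the rows and columns that deviate from `m`. Each of them crosses at least two
disagreeing edges, and all the spins `one` lie in their intersections, so there are at least
`2 * (r + c)` disagreeing edges and at most `r * c` spins `one` (`HasBackground.breaks_ge`,
`ones_le_mul`). This replaces the isoperimetric inequality and ignores the spins other than `one`
and `m`. Below the barrier it gives `r + c ≤ 2 * l`, hence on a torus with sides at least `3 * l` the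
background survives spin flips. With exactly `l * (l - 1)` spins `one`, the configuration has to be
a full rectangle with sides `l - 1` and `l` in a sea of `m` (`HasBackground.eq_rect`), and the next
spin `one` has to be adjacent to it. On a long side it makes a critical droplet. On a short side it
leads to a box with sides `l - 1` and `l + 1`, which cannot be left without either shrinking to
`l * (l - 1)` spins `one` or exceeding the barrier (`box_rigid`, `subcritical_step`).

*Every critical droplet is necessary.* Rectangles are grown line by line. A new line costs `2 - h` for
its first site and gains `h` for each further one, so that each critical droplet is the only state at
the level of the barrier on some path from `m` to `one` (`droplet`). Every gate then contains all the
critical droplets, and together they form a gate (`Landscape.isMinimalGate_and_gateUnion`).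

*Stability levels.* Subcritical configurations below the barrier do not have less energy than `m`
(`excess_nonneg_of_subcritical`), so the stability level of `m` is the barrier, which exceeds `2`. A
configuration that is not constant has stability level at most `2`: if its rows are not all equal,
its cheapest row is copied successively onto all the others (`exists_lower_of_rows`). This never
increases the number of vertical disagreements, and with a suitable starting point in each row, given
by the cycle lemma, the intermediate energies rise by at most the two seams of the copied arc. If the
rows are all equal, the same is done with the columns.
-/

noncomputable section

namespace Landscape

/-! ### Gates of a landscape -/

section Paths

variable {X : Type*} {G : SimpleGraph X} {H : X → ℝ}

/-- The states `x` and `y` are joined by a path that stays in `P`. -/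
def JoinedIn (G : SimpleGraph X) (P : Set X) (x y : X) : Prop :=
  ∃ p : G.Walk x y, ∀ z ∈ p.support, z ∈ P

theorem JoinedIn.refl {P : Set X} {x : X} (hx : x ∈ P) : JoinedIn G P x x :=
  ⟨.nil, by simpa using hx⟩

theorem JoinedIn.trans {P : Set X} {x y z : X} (hxy : JoinedIn G P x y)
    (hyz : JoinedIn G P y z) : JoinedIn G P x z := by
  obtain ⟨p, hp⟩ := hxy
  obtain ⟨r, hr⟩ := hyz
  refine ⟨p.append r, fun w hw => ?_⟩
  rcases SimpleGraph.Walk.mem_support_append_iff .. |>.1 hw with h | h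
  exacts [hp w h, hr w h]

theorem JoinedIn.mono {P Q : Set X} (hPQ : P ⊆ Q) {x y : X} (hxy : JoinedIn G P x y) :
    JoinedIn G Q x y := by
  obtain ⟨p, hp⟩ := hxy
  exact ⟨p, fun z hz => hPQ (hp z hz)⟩

theorem JoinedIn.of_adj {P : Set X} {x y : X} (hx : x ∈ P) (hy : y ∈ P) (hxy : G.Adj x y) :
    JoinedIn G P x y :=
  ⟨.cons hxy .nil, by simp [hx, hy]⟩

theorem JoinedIn.of_seq {P : Set X} (s : ℕ → X) (n : ℕ) (hP : ∀ k ≤ n, s k ∈ P)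
    (hs : ∀ k < n, s k = s (k + 1) ∨ G.Adj (s k) (s (k + 1))) : JoinedIn G P (s 0) (s n) := by
  induction n with
  | zero => exact .refl (hP 0 le_rfl)
  | succ n ih =>
    refine (ih (fun k hk => hP k (by omega)) fun k hk => hs k (by omega)).trans ?_
    rcases hs n (by omega) with h | h
    · rw [← h]; exact .refl (hP n (by omega))
    · exact .of_adj (hP n (by omega)) (hP _ le_rfl) h

theorem JoinedIn.map {Y : Type*} {G' : SimpleGraph Y} {P : Set X} {Q : Set Y} (f : G →g G')
    (hf : ∀ x ∈ P, f x ∈ Q) {x y : X} (hxy : JoinedIn G P x y) :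
    JoinedIn G' Q (f x) (f y) := by
  obtain ⟨p, hp⟩ := hxy
  refine ⟨p.map f, fun z hz => ?_⟩
  rw [SimpleGraph.Walk.support_map, List.mem_map] at hz
  obtain ⟨w, hw, rfl⟩ := hz
  exact hf w (hp w hw)

/-- A property of the first state of a path, inherited along each step up to the first visit of
`W`, holds at the last state if the path does not visit `W`. -/
theorem exists_mem_of_step {W : Set X} {P Good : Set X}
    (hstep : ∀ x y, x ∈ P → y ∈ P → x ∈ Good → G.Adj x y → y ∈ Good ∨ y ∈ W)
    {x y : X} (p : G.Walk x y) (hx : x ∈ Good) (hy : y ∉ Good) (hp : ∀ z ∈ p.support, z ∈ P) :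
    ∃ z ∈ p.support, z ∈ W := by
  induction p with
  | nil => exact absurd hx hy
  | cons hadj p ih =>
    rename_i u v w
    have hv : v ∈ (SimpleGraph.Walk.cons hadj p).support := by simp
    rcases hstep u v (hp u (by simp)) (hp v hv) hx hadj with h | h
    · obtain ⟨z, hz, hzW⟩ := ih h hy fun z hz => hp z (by simp [hz])
      exact ⟨z, by simp [hz], hzW⟩
    · exact ⟨v, hv, h⟩

theorem finite_image_support {x y : X} (p : G.Walk x y) : (H '' {z | z ∈ p.support}).Finite :=
  (List.finite_toSet p.support).image H

theorem le_height {x y : X} (p : G.Walk x y) {z : X} (hz : z ∈ p.support) : H z ≤ height H p :=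
  le_csSup (finite_image_support p).bddAbove ⟨z, hz, rfl⟩

theorem height_le {x y : X} (p : G.Walk x y) {c : ℝ} (hp : ∀ z ∈ p.support, H z ≤ c) :
    height H p ≤ c := by
  refine csSup_le ⟨H x, x, p.start_mem_support, rfl⟩ ?_
  rintro _ ⟨z, hz, rfl⟩
  exact hp z hz

theorem bddBelow_heights (x y : X) : BddBelow (Set.range fun p : G.Walk x y => height H p) := by
  refine ⟨H x, ?_⟩
  rintro _ ⟨p, rfl⟩
  exact le_height p p.start_mem_support

theorem commHeight_le {x y : X} (p : G.Walk x y) : commHeight G H x y ≤ height H p :=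
  csInf_le (bddBelow_heights x y) ⟨p, rfl⟩

theorem le_commHeight {x y : X} {c : ℝ} (hxy : G.Reachable x y)
    (hc : ∀ p : G.Walk x y, c ≤ height H p) : c ≤ commHeight G H x y := by
  obtain ⟨p⟩ := hxy
  refine le_csInf ⟨_, p, rfl⟩ ?_
  rintro _ ⟨p, rfl⟩
  exact hc p

theorem commHeight_le_of_joinedIn {x y : X} {c : ℝ} (hxy : JoinedIn G {z | H z ≤ c} x y) :
    commHeight G H x y ≤ c := by
  obtain ⟨p, hp⟩ := hxy
  exact (commHeight_le p).trans (height_le p hp)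

/-- A set `W` of states of energy `c` that separates `x` from `y` below level `c` has height at
least `c` on each path. -/
theorem le_height_of_separates {x y : X} {W : Set X} {c : ℝ}
    (hsep : ∀ p : G.Walk x y, (∀ z ∈ p.support, H z ≤ c) → ∃ z ∈ p.support, z ∈ W)
    (hW : ∀ w ∈ W, H w = c) (p : G.Walk x y) : c ≤ height H p := by
  by_cases hp : ∀ z ∈ p.support, H z ≤ c
  · obtain ⟨z, hz, hzW⟩ := hsep p hp
    exact (hW z hzW).symm.le.trans (le_height p hz)
  · push Not at hp
    obtain ⟨z, hz, hlt⟩ := hp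
    exact hlt.le.trans (le_height p hz)

/-- If `W` meets each path of height at most `c`, and if each state of `W` is the only state of
energy at least `c` on some path, then `W` is contained in every gate, hence it is the only minimal
gate. -/
theorem isMinimalGate_and_gateUnion {x y : X} {W : Set X} {c : ℝ} (hne : W.Nonempty)
    (hsep : ∀ p : G.Walk x y, (∀ z ∈ p.support, H z ≤ c) → ∃ z ∈ p.support, z ∈ W)
    (hW : ∀ w ∈ W, H w = c)
    (hpath : ∀ w ∈ W, ∃ p : G.Walk x y, w ∈ p.support ∧ ∀ z ∈ p.support, z ≠ w → H z < c) :
    commHeight G H x y = c ∧ IsMinimalGate G H x y W ∧ gateUnion G H x y = W := by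
  choose p hwp hp using hpath
  have hle : ∀ w (hw : w ∈ W), height H (p w hw) ≤ c := fun w hw => height_le _ fun z hz => by
    rcases eq_or_ne z w with rfl | hzw
    · exact (hW z hw).le
    · exact (hp w hw z hz hzw).le
  have hge := le_height_of_separates hsep hW
  have hcomm : commHeight G H x y = c := by
    obtain ⟨w, hw⟩ := hne
    exact le_antisymm ((commHeight_le _).trans (hle w hw)) (le_commHeight ⟨p w hw⟩ hge)
  have hopt : ∀ w (hw : w ∈ W), IsOptimal H (p w hw) := fun w hw => by
    rw [IsOptimal, hcomm]; exact le_antisymm (hle w hw) (hge _)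
  have hgate : IsGate G H x y W := by
    refine ⟨fun w hw => ⟨p w hw, hopt w hw, hwp w hw, ?_⟩, fun r hr => hsep r fun z hz => ?_⟩
    · rw [hW w hw]; exact le_antisymm (hge _) (hle w hw)
    · rw [IsOptimal, hcomm] at hr
      exact (le_height r hz).trans hr.le
  have hsub : ∀ W', IsGate G H x y W' → W ⊆ W' := fun W' hW' w hw => by
    obtain ⟨z, hz, hzW⟩ := hW'.2 _ (hopt w hw)
    obtain ⟨r, hr, -, hrz⟩ := hW'.1 hzW
    rw [IsOptimal, hcomm] at hr
    by_cases hzw : z = w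
    · exact hzw ▸ hzW
    · exact absurd (hp w hw z hz hzw) (by rw [hrz, hr]; exact lt_irrefl c)
  have hmin : IsMinimalGate G H x y W := by
    refine ⟨hgate, fun W' hW' => ?_⟩
    obtain ⟨w, hw, hwW'⟩ := Set.exists_of_ssubset hW'
    refine ⟨p w hw, hopt w hw, fun z hz hzW' => ?_⟩
    refine (hp w hw z hz fun hzw => hwW' (hzw ▸ hzW')).ne ?_
    exact hW z (hW'.1 hzW')
  refine ⟨hcomm, hmin, Set.eq_of_subset_of_subset ?_ fun w hw => ⟨W, hmin, hw⟩⟩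
  rintro w ⟨W', hW', hw⟩
  by_contra hwW
  have hss : W ⊂ W' := ⟨hsub W' hW'.1, fun hle => hwW (hle hw)⟩
  obtain ⟨r, hr, hrW⟩ := hW'.2 W hss
  obtain ⟨z, hz, hzW⟩ := hgate.2 r hr
  exact hrW z hz hzW

theorem stabilityLevel_le [Finite X] {x z : X} {c : ℝ} (hz : H z < H x)
    (hxz : JoinedIn G {w | H w ≤ H x + c} x z) : stabilityLevel G H x ≤ (c : ℝ) := by
  have hne : (lower H x).Nonempty := ⟨z, hz⟩
  rw [stabilityLevel, if_pos hne, WithTop.coe_le_coe, sub_le_iff_le_add, add_comm]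
  exact (csInf_le (Set.toFinite (commHeight G H x '' lower H x)).bddBelow
    (Set.mem_image_of_mem _ hz)).trans (commHeight_le_of_joinedIn hxz)

theorem le_stabilityLevel (hG : G.Preconnected) {x : X} {c : ℝ}
    (hc : ∀ z, H z < H x → ∀ p : G.Walk x z, H x + c ≤ height H p) :
    (c : ℝ) ≤ stabilityLevel G H x := by
  rw [stabilityLevel]
  split_ifs with hne
  · rw [WithTop.coe_le_coe, le_sub_iff_add_le, add_comm]
    refine le_csInf (hne.image _) ?_
    rintro _ ⟨z, hz, rfl⟩
    exact le_commHeight (hG x z) (hc z hz)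
  · exact le_top

end Paths

end Landscape

namespace Potts

/-! ### Boundaries on a cycle -/

section Cycle

variable {n : ℕ} {α : Type*}

theorem eq_add_of_forall_ne {f : ZMod n → α} (a : ZMod n)
    (hf : ∀ j, j ≠ a → f j = f (j + 1)) (k : ℕ) (hk : k < n) : f (a + 1 + k) = f (a + 1) := by
  induction k with
  | zero => simp
  | succ k ih =>
    rw [← ih (by omega), Nat.cast_succ, ← add_assoc]
    refine (hf _ fun h => ?_).symm
    have h1 : ((k + 1 : ℕ) : ZMod n) = 0 := by
      push_cast
      linear_combination h
    rw [ZMod.natCast_eq_zero_iff] at h1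
    exact absurd (Nat.le_of_dvd (by omega) h1) (by omega)

theorem natCast_inj_of_lt {i j : ℕ} (hi : i < n) (hj : j < n) (h : (i : ZMod n) = j) : i = j := by
  rw [ZMod.natCast_eq_natCast_iff'] at h
  rwa [Nat.mod_eq_of_lt hi, Nat.mod_eq_of_lt hj] at h

/-- The image of the interval `[a, a + t)` in the cycle `ZMod n`. -/
def arc (a : ZMod n) (t : ℕ) : Finset (ZMod n) :=
  (Finset.range t).image fun i : ℕ => a + (i : ZMod n)

theorem mem_arc {a : ZMod n} {t : ℕ} {x : ZMod n} :
    x ∈ arc a t ↔ ∃ i < t, x = a + (i : ZMod n) := by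
  simp only [arc, Finset.mem_image, Finset.mem_range, eq_comm (a := x)]

theorem card_arc {a : ZMod n} {t : ℕ} (ht : t ≤ n) : (arc a t).card = t := by
  rw [arc, Finset.card_image_of_injOn, Finset.card_range]
  intro i hi j hj hij
  simp only [Finset.coe_range, Set.mem_Iio] at hi hj
  exact natCast_inj_of_lt (by omega) (by omega) (add_left_cancel hij)

theorem add_notMem_arc {a : ZMod n} {t k : ℕ} (htk : t ≤ k) (hk : k < n) :
    a + (k : ZMod n) ∉ arc a t := by
  rw [mem_arc]
  rintro ⟨i, hi, h⟩
  have := natCast_inj_of_lt hk (by omega) (add_left_cancel h)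
  omega

variable [NeZero n]

open Classical in
/-- The number of the edges of the cycle `ZMod n` on which `f` takes two different values. -/
def bdry (f : ZMod n → α) : ℕ :=
  (Finset.univ.filter fun j => f j ≠ f (j + 1)).card

theorem exists_eq_add_natCast (a x : ZMod n) : ∃ k < n, x = a + (k : ZMod n) :=
  ⟨(x - a).val, ZMod.val_lt _, by rw [ZMod.natCast_zmod_val]; ring⟩

/-- A function on a cycle that is not constant changes its value on at least two edges. -/
theorem two_le_bdry {f : ZMod n → α} {x y : ZMod n} (hxy : f x ≠ f y) : 2 ≤ bdry f := by
  classical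
  by_contra! hlt
  have hex : ∃ a, ∀ j, j ≠ a → f j = f (j + 1) := by
    have h1 : (Finset.univ.filter fun j => f j ≠ f (j + 1)).card ≤ 1 := by
      have := hlt
      rw [bdry] at this
      convert Nat.le_of_lt_succ this
    rw [Finset.card_le_one_iff_subset_singleton] at h1
    obtain ⟨a, ha⟩ := h1
    refine ⟨a, fun j hj => ?_⟩
    by_contra hne
    exact hj (Finset.mem_singleton.1 (ha (by simpa using hne)))
  obtain ⟨a, ha⟩ := hex
  obtain ⟨k, hk, rfl⟩ := exists_eq_add_natCast (a + 1) x
  obtain ⟨l, hl, rfl⟩ := exists_eq_add_natCast (a + 1) y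
  exact hxy ((eq_add_of_forall_ne a ha k hk).trans (eq_add_of_forall_ne a ha l hl).symm)

/-- The numbers of the edges on which a cycle enters and leaves a set are equal, so that fewer than
four boundary edges leave a single entry and a single exit. -/
theorem eq_arc_of_bdry_lt_four {C : Finset (ZMod n)} (hC : C.Nonempty) (hC' : C ≠ Finset.univ)
    (hb : bdry (fun j => j ∈ C) < 4) : ∃ a, C = arc a C.card := by
  classical
  have hin : ∃ a ∈ C, a - 1 ∉ C := by
    by_contra! hno
    obtain ⟨a, ha⟩ := hC
    refine hC' (Finset.eq_univ_iff_forall.2 fun x => ?_)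
    have : ∀ k : ℕ, a - k ∈ C := fun k => by
      induction k with
      | zero => simpa using ha
      | succ k ih => rw [Nat.cast_succ, ← sub_sub]; exact hno _ ih
    obtain ⟨k, -, hk⟩ := exists_eq_add_natCast x a
    have h := this k
    rwa [hk, add_sub_cancel_right] at h
  obtain ⟨a, ha, ha'⟩ := hin
  set I := Finset.univ.filter fun j => j ∉ C ∧ j + 1 ∈ C with hI
  set O := Finset.univ.filter fun j => j ∈ C ∧ j + 1 ∉ C with hO
  have hcard : I.card = O.card := by
    have h1 : I.card + (Finset.univ.filter fun j => j ∈ C ∧ j + 1 ∈ C).card = C.card := by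
      rw [← Finset.card_union_of_disjoint]
      · rw [← Finset.card_map (Equiv.addRight (1 : ZMod n)).toEmbedding]
        congr 1
        ext x
        simp only [hI, Finset.mem_map, Finset.mem_union, Finset.mem_filter, Finset.mem_univ,
          true_and, Equiv.coe_toEmbedding, Equiv.coe_addRight]
        constructor
        · rintro ⟨y, hy | hy, rfl⟩
          exacts [hy.2, hy.2]
        · intro hx
          exact ⟨x - 1, by simp only [sub_add_cancel]; tauto, by ring⟩
      · rw [Finset.disjoint_filter]
        tauto
    have h2 : O.card + (Finset.univ.filter fun j => j ∈ C ∧ j + 1 ∈ C).card = C.card := by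
      rw [← Finset.card_union_of_disjoint]
      · congr 1
        ext x
        simp only [hO, Finset.mem_union, Finset.mem_filter, Finset.mem_univ, true_and]
        tauto
      · rw [Finset.disjoint_filter]
        tauto
    omega
  have hsum : I.card + O.card = bdry (fun j => j ∈ C) := by
    rw [bdry, ← Finset.card_union_of_disjoint]
    · congr 1
      ext x
      simp only [hI, hO, Finset.mem_union, Finset.mem_filter, Finset.mem_univ, true_and, ne_eq,
        eq_iff_iff]
      tauto
    · rw [Finset.disjoint_filter]
      tauto
  have hone : I.card ≤ 1 := by omega
  have huniq : ∀ x ∈ C, x - 1 ∉ C → x = a := fun x hx hx' => by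
    have := Finset.card_le_one.1 hone (x - 1) (by simp [hI, hx, hx']) (a - 1)
      (by simp [hI, ha, ha'])
    linear_combination this
  -- each element of `C` is reached from the only entry without leaving `C`
  have hreach : ∀ k : ℕ, k < n → a + (k : ZMod n) ∈ C → ∀ i ≤ k, a + (i : ZMod n) ∈ C := by
    intro k hk hkC
    induction k with
    | zero => intro i hi; obtain rfl : i = 0 := by omega
              exact hkC
    | succ k ih =>
      have hk' : a + (k : ZMod n) ∈ C := by
        by_contra hkn
        have h1 : a + ((k + 1 : ℕ) : ZMod n) = a := huniq _ hkC (by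
          rwa [Nat.cast_succ, ← add_assoc, add_sub_cancel_right])
        have h2 : ((k + 1 : ℕ) : ZMod n) = 0 := by linear_combination h1
        rw [ZMod.natCast_eq_zero_iff] at h2
        exact absurd (Nat.le_of_dvd (by omega) h2) (by omega)
      intro i hi
      rcases Nat.lt_or_ge i (k + 1) with h | h
      · exact ih (by omega) hk' i (by omega)
      · obtain rfl : i = k + 1 := by omega
        exact hkC
  have hex : ∃ t : ℕ, a + (t : ZMod n) ∉ C := by
    by_contra! hall
    refine hC' (Finset.eq_univ_iff_forall.2 fun x => ?_)
    obtain ⟨k, -, rfl⟩ := exists_eq_add_natCast a x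
    exact hall k
  have hfind : Nat.find hex < n := by
    have hx := Nat.find_spec hex
    obtain ⟨k, hk, hk'⟩ := exists_eq_add_natCast a (a + (Nat.find hex : ZMod n))
    exact (Nat.find_min' hex (hk' ▸ hx)).trans_lt hk
  have heq : C = arc a (Nat.find hex) := by
    ext x
    rw [mem_arc]
    constructor
    · intro hx
      obtain ⟨k, hk, rfl⟩ := exists_eq_add_natCast a x
      refine ⟨k, ?_, rfl⟩
      by_contra! hle
      exact Nat.find_spec hex (hreach k hk hx _ hle)
    · rintro ⟨i, hi, rfl⟩
      exact not_not.1 (Nat.find_min hex hi)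
  refine ⟨a, ?_⟩
  have hc : C.card = Nat.find hex := by
    conv_lhs => rw [heq]
    exact card_arc hfind.le
  rw [hc]
  exact heq

end Cycle

end Potts

namespace Potts

/-! ### The energy through disagreeing edges -/

/-- The cost of an edge between the values `x` and `y`: `0` if they agree, `1` otherwise. -/
def dis {α : Type*} (x y : α) : ℝ :=
  open Classical in if x = y then 0 else 1

theorem dis_self {α : Type*} (x : α) : dis x x = 0 := if_pos rfl

theorem dis_of_ne {α : Type*} {x y : α} (hxy : x ≠ y) : dis x y = 1 := if_neg hxy

theorem dis_nonneg {α : Type*} (x y : α) : 0 ≤ dis x y := by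
  unfold dis; split_ifs <;> norm_num

theorem dis_le_one {α : Type*} (x y : α) : dis x y ≤ 1 := by
  unfold dis; split_ifs <;> norm_num

theorem dis_comm {α : Type*} (x y : α) : dis x y = dis y x := by
  by_cases hxy : x = y
  · rw [hxy]
  · rw [dis_of_ne hxy, dis_of_ne (Ne.symm hxy)]

theorem dis_triangle {α : Type*} (x y z : α) : dis x z ≤ dis x y + dis y z := by
  by_cases hxy : x = y
  · rw [hxy, dis_self, zero_add]
  · rw [dis_of_ne hxy]
    linarith [dis_nonneg y z, dis_le_one x z]

theorem dis_sub_dis_le {α : Type*} (x s t : α) : dis x s - dis x t ≤ 1 := by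
  linarith [dis_le_one x s, dis_nonneg x t]

section Cycle

variable {n : ℕ} [NeZero n] {α : Type*}

theorem cast_bdry (f : ZMod n → α) : (bdry f : ℝ) = ∑ j, dis (f j) (f (j + 1)) := by
  classical
  rw [bdry, Finset.card_filter, Nat.cast_sum]
  refine Finset.sum_congr rfl fun j _ => ?_
  unfold dis
  split_ifs <;> simp_all

theorem bdry_update [DecidableEq (ZMod n)] (hn : 2 ≤ n) (f : ZMod n → α) (j : ZMod n) (s : α) :
    (bdry (Function.update f j s) : ℝ) = bdry f + (dis (f (j - 1)) s - dis (f (j - 1)) (f j))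
      + (dis (f (j + 1)) s - dis (f (j + 1)) (f j)) := by
  have h1 : (1 : ZMod n) ≠ 0 := by
    intro h
    have : ((1 : ℕ) : ZMod n) = (0 : ℕ) := by simpa using h
    exact absurd (natCast_inj_of_lt (by omega) (by omega) this) one_ne_zero
  have hj1 : j + 1 ≠ j := fun h => h1 (by linear_combination h)
  have hj2 : j - 1 ≠ j := fun h => h1 (by linear_combination -h)
  suffices h : ∑ x, (dis (Function.update f j s x) (Function.update f j s (x + 1))
      - dis (f x) (f (x + 1))) = (dis (f (j - 1)) s - dis (f (j - 1)) (f j))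
      + (dis (f (j + 1)) s - dis (f (j + 1)) (f j)) by
    rw [Finset.sum_sub_distrib] at h
    rw [cast_bdry, cast_bdry]
    linarith
  rw [Finset.sum_eq_add (j - 1) j hj2]
  · rw [sub_add_cancel, Function.update_self, Function.update_of_ne hj2, Function.update_of_ne hj1,
      dis_comm s, dis_comm (f j)]
  · intro x _ hx
    rw [Function.update_of_ne hx.2, Function.update_of_ne fun h => hx.1 (by rw [← h]; ring),
      sub_self]
  · simp
  · simp

end Cycle

variable {K L q : ℕ} [NeZero K] [NeZero L]

theorem flipGraph_adj {σ τ : Config K L q} :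
    (flipGraph K L q).Adj σ τ ↔ ∃ v, σ v ≠ τ v ∧ ∀ u, u ≠ v → σ u = τ u := by
  change hammingDist σ τ = 1 ↔ _
  rw [hammingDist, Finset.card_eq_one]
  refine exists_congr fun v => ?_
  rw [Finset.ext_iff]
  simp only [Finset.mem_filter, Finset.mem_univ, true_and, Finset.mem_singleton]
  constructor
  · intro hv
    refine ⟨(hv v).2 rfl, fun u hu => ?_⟩
    by_contra hne
    exact hu ((hv u).1 hne)
  · rintro ⟨hv, hu⟩ u
    refine ⟨fun hne => ?_, fun huv => huv ▸ hv⟩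
    by_contra huv
    exact hne (hu u huv)

theorem flipGraph_preconnected : (flipGraph K L q).Preconnected := by
  classical
  intro σ τ
  suffices h : ∀ S : Finset (Site K L), (flipGraph K L q).Reachable σ (S.piecewise τ σ) by
    simpa using h Finset.univ
  intro S
  induction S using Finset.induction_on with
  | empty => simp
  | insert v S hv ih =>
    refine ih.trans ?_
    rw [Finset.piecewise_insert]
    by_cases hst : S.piecewise τ σ v = τ v
    · rw [← hst, Function.update_eq_self]
    · refine SimpleGraph.Adj.reachable (flipGraph_adj.2 ⟨v, ?_, fun u hu => ?_⟩)
      · simpa using hst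
      · rw [Function.update_of_ne hu]

variable [NeZero q]

/-- The number of the edges of the torus whose two ends have different spins. -/
def breaks (σ : Config K L q) : ℕ :=
  ∑ i, bdry (fun j => σ (i, j)) + ∑ j, bdry (fun i => σ (i, j))

/-- The number of the spins that are equal to `one`. -/
def ones (σ : Config K L q) : ℕ := (Finset.univ.filter fun v => σ v = one).card

/-- The energy relative to that of a constant configuration not equal to `one`. -/
def excess (h : ℝ) (σ : Config K L q) : ℝ := breaks σ - h * ones σ

theorem cast_ones (σ : Config K L q) :
    (ones σ : ℝ) = ∑ v : Site K L, if σ v = one then (1 : ℝ) else 0 := by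
  rw [ones, Finset.card_filter, Nat.cast_sum]
  simp

theorem energy_eq (h : ℝ) (σ : Config K L q) :
    energy h σ = excess h σ - 2 * K * L := by
  have hH : ∑ v : Site K L, (if σ v = σ (v + (0, 1)) then (1 : ℝ) else 0)
      = K * L - ∑ i, (bdry (fun j => σ (i, j)) : ℝ) := by
    rw [eq_sub_iff_add_eq, Fintype.sum_prod_type, ← Finset.sum_add_distrib]
    simp_rw [cast_bdry, ← Finset.sum_add_distrib]
    rw [Finset.sum_congr rfl fun i _ => Finset.sum_congr rfl (g := fun _ => (1 : ℝ)) fun j _ => ?_]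
    · simp
    · rw [Prod.mk_add_mk, add_zero]; unfold dis; split_ifs <;> norm_num
  have hV : ∑ v : Site K L, (if σ v = σ (v + (1, 0)) then (1 : ℝ) else 0)
      = K * L - ∑ j, (bdry (fun i => σ (i, j)) : ℝ) := by
    rw [eq_sub_iff_add_eq, Fintype.sum_prod_type_right, ← Finset.sum_add_distrib]
    simp_rw [cast_bdry, ← Finset.sum_add_distrib]
    rw [Finset.sum_congr rfl fun i _ => Finset.sum_congr rfl (g := fun _ => (1 : ℝ)) fun j _ => ?_]
    · simp [mul_comm]
    · rw [Prod.mk_add_mk, add_zero]; unfold dis; split_ifs <;> norm_num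
  rw [energy, Finset.sum_add_distrib, hH, hV, ← cast_ones, excess, breaks]
  push_cast
  ring

theorem excess_update [DecidableEq (Site K L)] (hK : 2 ≤ K) (hL : 2 ≤ L) (h : ℝ)
    (σ : Config K L q) (v : Site K L) (s : Fin q) :
    excess h (Function.update σ v s) = excess h σ
      + (dis (σ (v - (1, 0))) s - dis (σ (v - (1, 0))) (σ v))
      + (dis (σ (v + (1, 0))) s - dis (σ (v + (1, 0))) (σ v))
      + (dis (σ (v - (0, 1))) s - dis (σ (v - (0, 1))) (σ v))
      + (dis (σ (v + (0, 1))) s - dis (σ (v + (0, 1))) (σ v))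
      - h * ((if s = one then 1 else 0) - (if σ v = one then 1 else 0)) := by
  obtain ⟨i₀, j₀⟩ := v
  have hrow : ∑ i, (bdry (fun j => Function.update σ (i₀, j₀) s (i, j)) : ℝ)
      = ∑ i, (bdry (fun j => σ (i, j)) : ℝ)
        + ((bdry (Function.update (fun j => σ (i₀, j)) j₀ s) : ℝ) - bdry (fun j => σ (i₀, j))) := by
    rw [← sub_eq_iff_eq_add', ← Finset.sum_sub_distrib, Finset.sum_eq_single i₀]
    · congr 3
      ext j
      by_cases hj : j = j₀ <;> simp [hj]
    · intro i _ hi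
      rw [sub_eq_zero]
      congr 2
      ext j
      simp [hi]
    · simp
  have hcol : ∑ j, (bdry (fun i => Function.update σ (i₀, j₀) s (i, j)) : ℝ)
      = ∑ j, (bdry (fun i => σ (i, j)) : ℝ)
        + ((bdry (Function.update (fun i => σ (i, j₀)) i₀ s) : ℝ) - bdry (fun i => σ (i, j₀))) := by
    rw [← sub_eq_iff_eq_add', ← Finset.sum_sub_distrib, Finset.sum_eq_single j₀]
    · congr 3
      ext i
      by_cases hi : i = i₀ <;> simp [hi]
    · intro j _ hj
      rw [sub_eq_zero]
      congr 2
      ext i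
      simp [hj]
    · simp
  have hones : (ones (Function.update σ (i₀, j₀) s) : ℝ) = ones σ
      + ((if s = one then 1 else 0) - (if σ (i₀, j₀) = one then 1 else 0)) := by
    rw [cast_ones, cast_ones, ← sub_eq_iff_eq_add', ← Finset.sum_sub_distrib,
      Finset.sum_eq_single (i₀, j₀)]
    · simp
    · intro u _ hu
      rw [Function.update_of_ne hu, sub_self]
    · simp
  rw [excess, excess, breaks, breaks]
  push_cast
  rw [hrow, hcol, hones, bdry_update hL, bdry_update hK]
  simp only [Prod.mk_sub_mk, Prod.mk_add_mk, sub_zero, add_zero]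
  ring

theorem excess_const (h : ℝ) {m : Fin q} (hm : m ≠ one) :
    excess h (const m : Config K L q) = 0 := by
  simp [excess, breaks, ones, bdry, const, hm]

theorem excess_const_one (h : ℝ) : excess h (const one : Config K L q) = -(h * (K * L)) := by
  simp [excess, breaks, ones, bdry, const]

theorem ones_le_card (σ : Config K L q) : ones σ ≤ K * L := by
  refine (Finset.card_filter_le _ _).trans ?_
  simp

/-- The configuration with all spins equal to `one` is the only stable one. -/
theorem stable_energy {h : ℝ} (h_pos : 0 < h) :
    Landscape.stable (energy (K := K) (L := L) (q := q) h) = {const one} := by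
  have hlow : ∀ σ : Config K L q, excess h (const one : Config K L q) ≤ excess h σ := fun σ => by
    have h1 : (ones σ : ℝ) ≤ K * L := by exact_mod_cast ones_le_card σ
    have h2 : (0 : ℝ) ≤ breaks σ := Nat.cast_nonneg _
    rw [excess_const_one, excess]
    nlinarith
  ext σ
  simp only [Landscape.stable, Set.mem_ofPred_eq, Set.mem_singleton_iff, energy_eq,
    sub_le_sub_iff_right]
  refine ⟨fun hσ => ?_, fun hσ τ => hσ ▸ hlow τ⟩
  have h1 := hσ (const one)
  have h2 : (0 : ℝ) ≤ breaks σ := Nat.cast_nonneg _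
  rw [excess_const_one, excess] at h1
  have h3 : (K * L : ℝ) ≤ ones σ := by
    by_contra! hlt
    nlinarith
  have h4 : K * L ≤ ones σ := by exact_mod_cast h3
  have h5 : (Finset.univ.filter fun v => σ v = one) = Finset.univ := by
    rw [← Finset.card_eq_iff_eq_univ]
    refine le_antisymm (Finset.card_le_univ _) ?_
    simpa [ones] using h4
  ext v
  have h6 := Finset.mem_univ v
  rw [← h5, Finset.mem_filter] at h6
  rw [h6.2]; rfl

end Potts

namespace Potts

/-! ### The critical length -/

/-- The number `l` is the critical length of the field `h`: a side of length `l` of a rectangle of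
spins `one` tends to grow (`2 < h * l`), a shorter side tends to shrink. -/
structure IsCritical (h : ℝ) (l : ℕ) : Prop where
  pos : 0 < h
  lt_one : h < 1
  three_le : 3 ≤ l
  shrink : h * (l - 1) < 2
  grow : 2 < h * l

theorem isCritical_critLen {h : ℝ} (h_pos : 0 < h) (h_lt : h < 1) (h_int : ∀ n : ℕ, 2 / h ≠ n) :
    IsCritical h (critLen h) := by
  have h1 : 2 / h < critLen h := lt_of_le_of_ne (Nat.le_ceil _) (h_int _)
  have h2 : (critLen h : ℝ) < 2 / h + 1 := Nat.ceil_lt_add_one (by positivity)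
  refine ⟨h_pos, h_lt, ?_, ?_, ?_⟩
  · have h3 : (2 : ℝ) < 2 / h := by rw [lt_div_iff₀ h_pos]; linarith
    have h4 : ((2 : ℕ) : ℝ) < critLen h := by push_cast; linarith
    exact Nat.cast_lt.1 h4
  · have h3 : (critLen h : ℝ) - 1 < 2 / h := by linarith
    rw [lt_div_iff₀ h_pos] at h3
    linarith
  · rw [div_lt_iff₀ h_pos] at h1
    linarith

/-- The energy of a critical droplet, a rectangle with sides `l - 1` and `l` with one additional
site adjacent to it. -/
def barrier (h : ℝ) (l : ℕ) : ℝ := 4 * l - h * (l * (l - 1) + 1)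

theorem cast_mul_pred {l : ℕ} (hl : 3 ≤ l) : ((l * (l - 1) : ℕ) : ℝ) = l * (l - 1) := by
  rw [Nat.cast_mul, Nat.cast_sub (by omega), Nat.cast_one]

theorem barrier_gt {h : ℝ} {l : ℕ} (hl : IsCritical h l) : 2 * l - h < barrier h l := by
  have h1 : (3 : ℝ) ≤ l := by exact_mod_cast hl.three_le
  have h2 := hl.shrink
  rw [barrier]
  nlinarith

/-! ### Rows and columns that deviate from a background spin -/

variable {K L q : ℕ} [NeZero K] [NeZero L]

open Classical in
/-- The rows that contain a spin different from `m`. -/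
def devRows (m : Fin q) (σ : Config K L q) : Finset (ZMod K) :=
  Finset.univ.filter fun i => ∃ j, σ (i, j) ≠ m

open Classical in
/-- The columns that contain a spin different from `m`. -/
def devCols (m : Fin q) (σ : Config K L q) : Finset (ZMod L) :=
  Finset.univ.filter fun j => ∃ i, σ (i, j) ≠ m

theorem mem_devRows {m : Fin q} {σ : Config K L q} {i : ZMod K} :
    i ∈ devRows m σ ↔ ∃ j, σ (i, j) ≠ m := by
  simp [devRows]

theorem mem_devCols {m : Fin q} {σ : Config K L q} {j : ZMod L} :
    j ∈ devCols m σ ↔ ∃ i, σ (i, j) ≠ m := by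
  simp [devCols]

theorem breaks_ge_of_bdry_ge {m : Fin q} {σ : Config K L q} {x y : ℕ}
    (hx : ∀ i ∈ devRows m σ, x ≤ bdry fun j => σ (i, j))
    (hy : ∀ j ∈ devCols m σ, y ≤ bdry fun i => σ (i, j)) :
    (devRows m σ).card * x + (devCols m σ).card * y ≤ breaks σ := by
  refine add_le_add ?_ ?_
  · exact (Finset.card_nsmul_le_sum _ _ _ hx).trans
      (Finset.sum_le_sum_of_subset (Finset.subset_univ _))
  · exact (Finset.card_nsmul_le_sum _ _ _ hy).trans
      (Finset.sum_le_sum_of_subset (Finset.subset_univ _))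

/-- If some row and some column are constantly `m`, then `m` is the background spin. -/
def HasBackground (m : Fin q) (σ : Config K L q) : Prop :=
  devRows m σ ≠ Finset.univ ∧ devCols m σ ≠ Finset.univ

theorem HasBackground.exists_row {m : Fin q} {σ : Config K L q} (hσ : HasBackground m σ) :
    ∃ i, ∀ j, σ (i, j) = m := by
  have h := hσ.1
  rw [ne_eq, Finset.eq_univ_iff_forall] at h
  simpa [mem_devRows] using h

theorem HasBackground.exists_col {m : Fin q} {σ : Config K L q} (hσ : HasBackground m σ) :
    ∃ j, ∀ i, σ (i, j) = m := by
  have h := hσ.2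
  rw [ne_eq, Finset.eq_univ_iff_forall] at h
  simpa [mem_devCols] using h

/-- An isoperimetric inequality: a row or column that is not constantly equal to the background
spin crosses at least two disagreeing edges. -/
theorem HasBackground.breaks_ge {m : Fin q} {σ : Config K L q} (hσ : HasBackground m σ) :
    2 * ((devRows m σ).card + (devCols m σ).card) ≤ breaks σ := by
  obtain ⟨i₀, hi₀⟩ := hσ.exists_row
  obtain ⟨j₀, hj₀⟩ := hσ.exists_col
  have := breaks_ge_of_bdry_ge (m := m) (σ := σ) (x := 2) (y := 2)
    (fun i hi => by
      obtain ⟨j, hj⟩ := mem_devRows.1 hi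
      exact two_le_bdry (x := j) (y := j₀) (by simpa [hj₀] using hj))
    (fun j hj => by
      obtain ⟨i, hi⟩ := mem_devCols.1 hj
      exact two_le_bdry (x := i) (y := i₀) (by simpa [hi₀] using hi))
  omega

variable [NeZero q]

theorem filter_one_subset {m : Fin q} (hm : m ≠ one) (σ : Config K L q) :
    (Finset.univ.filter fun v => σ v = one) ⊆ devRows m σ ×ˢ devCols m σ := by
  intro v hv
  have hv' : σ (v.1, v.2) = one := (Finset.mem_filter.1 hv).2
  rw [Finset.mem_product, mem_devRows, mem_devCols]
  exact ⟨⟨v.2, by rw [hv']; exact hm.symm⟩, ⟨v.1, by rw [hv']; exact hm.symm⟩⟩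

theorem ones_le_mul {m : Fin q} (hm : m ≠ one) (σ : Config K L q) :
    ones σ ≤ (devRows m σ).card * (devCols m σ).card := by
  rw [← Finset.card_product]
  exact Finset.card_le_card (filter_one_subset hm σ)

theorem HasBackground.excess_ge {h : ℝ} {m : Fin q} {σ : Config K L q}
    (hσ : HasBackground m σ) :
    2 * ((devRows m σ).card + (devCols m σ).card : ℝ) - h * ones σ ≤ excess h σ := by
  have h1 : ((2 * ((devRows m σ).card + (devCols m σ).card) : ℕ) : ℝ) ≤ breaks σ :=
    Nat.cast_le.2 hσ.breaks_ge
  push_cast at h1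
  rw [excess]
  linarith

theorem HasBackground.card_add_card_le {h : ℝ} {l : ℕ} (hl : IsCritical h l) {m : Fin q}
    {σ : Config K L q} (hσ : HasBackground m σ) (hones : ones σ ≤ l * l)
    (hE : excess h σ ≤ barrier h l) : (devRows m σ).card + (devCols m σ).card ≤ 2 * l := by
  have h1 := hσ.excess_ge (h := h)
  have h2 : (ones σ : ℝ) ≤ l * l := by exact_mod_cast hones
  have h3 : h * ones σ ≤ h * (l * l) := mul_le_mul_of_nonneg_left h2 hl.pos.le
  have h4 := hl.shrink
  rw [barrier] at hE
  have h5 : ((devRows m σ).card + (devCols m σ).card : ℝ) < 2 * l + 1 := by linarith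
  have h6 : (devRows m σ).card + (devCols m σ).card < 2 * l + 1 := by exact_mod_cast h5
  omega

theorem HasBackground.card_add_card_lt {h : ℝ} {l : ℕ} (hl : IsCritical h l) {m : Fin q}
    {σ : Config K L q} (hσ : HasBackground m σ) (hones : ones σ ≤ l * (l - 1))
    (hE : excess h σ ≤ barrier h l) : (devRows m σ).card + (devCols m σ).card < 2 * l := by
  have h1 := hσ.excess_ge (h := h)
  have h2 : (ones σ : ℝ) ≤ l * (l - 1) := by
    rw [← cast_mul_pred hl.three_le]; exact_mod_cast hones
  have h3 : h * ones σ ≤ h * (l * (l - 1)) := mul_le_mul_of_nonneg_left h2 hl.pos.le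
  have h4 := hl.pos
  rw [barrier] at hE
  have h5 : ((devRows m σ).card + (devCols m σ).card : ℝ) < 2 * l := by linarith
  exact_mod_cast h5

/-- Among the boxes of half perimeter less than `2 * l`, only those with sides `l - 1` and `l` have
room for `l * (l - 1)` sites. -/
theorem eq_of_mul_ge {l r c : ℕ} (hl : 3 ≤ l) (hrc : r + c < 2 * l) (hmul : l * (l - 1) ≤ r * c) :
    (r = l - 1 ∧ c = l) ∨ (r = l ∧ c = l - 1) := by
  obtain ⟨k, rfl⟩ : ∃ k, l = k + 1 := ⟨l - 1, by omega⟩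
  simp only [Nat.add_sub_cancel] at *
  have h1 : r ≤ c + 1 := by
    by_contra! hlt
    obtain ⟨d, rfl⟩ : ∃ d, r = c + 2 + d := ⟨r - (c + 2), by omega⟩
    nlinarith
  have h2 : c ≤ r + 1 := by
    by_contra! hlt
    obtain ⟨d, rfl⟩ : ∃ d, c = r + 2 + d := ⟨c - (r + 2), by omega⟩
    nlinarith
  have h3 : 2 * k + 1 ≤ r + c := by
    by_contra! hlt
    nlinarith [sq_nonneg ((r : ℤ) - c)]
  omega

/-! ### The droplet at the barrier -/

theorem bdry_congr {n : ℕ} [NeZero n] {α β : Type*} {f : ZMod n → α} {g : ZMod n → β}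
    (hfg : ∀ x y, f x = f y ↔ g x = g y) : bdry f = bdry g := by
  unfold bdry
  congr 1
  ext j
  simp [hfg]

theorem eq_add_of_notMem_arc {n : ℕ} {a x : ZMod n} {t : ℕ} (hx : x ∉ arc a t)
    (hx' : x - 1 ∈ arc a t) : x = a + (t : ZMod n) := by
  obtain ⟨i, hi, h⟩ := mem_arc.1 hx'
  have hxi : x = a + ((i + 1 : ℕ) : ZMod n) := by push_cast; linear_combination h
  obtain rfl : i + 1 = t := by
    by_contra hne
    exact hx (mem_arc.2 ⟨i + 1, by omega, hxi⟩)
  exact hxi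

theorem eq_sub_of_notMem_arc {n : ℕ} {a x : ZMod n} {t : ℕ} (hx : x ∉ arc a t)
    (hx' : x + 1 ∈ arc a t) : x = a - 1 := by
  obtain ⟨i, hi, h⟩ := mem_arc.1 hx'
  obtain rfl : i = 0 := by
    by_contra hne
    refine hx (mem_arc.2 ⟨i - 1, by omega, ?_⟩)
    rw [Nat.cast_sub (by omega)]
    push_cast
    linear_combination h
  push_cast at h
  linear_combination h

/-- A configuration with background `m` and `l * (l - 1)` spins `one`, of energy at most the
barrier, is a rectangle with sides `l - 1` and `l` of spins `one` in a sea of spins `m`. -/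
theorem HasBackground.eq_rect {h : ℝ} {l : ℕ} (hl : IsCritical h l) {m : Fin q} (hm : m ≠ one)
    {σ : Config K L q} (hσ : HasBackground m σ) (hones : ones σ = l * (l - 1))
    (hE : excess h σ ≤ barrier h l) :
    (((devRows m σ).card = l - 1 ∧ (devCols m σ).card = l) ∨
      ((devRows m σ).card = l ∧ (devCols m σ).card = l - 1)) ∧
    (∀ i j, i ∈ devRows m σ → j ∈ devCols m σ → σ (i, j) = one) ∧
    (∃ a, devRows m σ = arc a (devRows m σ).card) ∧
    (∃ b, devCols m σ = arc b (devCols m σ).card) := by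
  have hlt := hσ.card_add_card_lt hl hones.le hE
  have hcard := eq_of_mul_ge hl.three_le hlt (hones ▸ ones_le_mul hm σ)
  have hmul : (devRows m σ).card * (devCols m σ).card = ones σ := by
    rw [hones]
    rcases hcard with ⟨h1, h2⟩ | ⟨h1, h2⟩ <;> rw [h1, h2]
    rw [mul_comm]
  have hfill : ∀ i j, i ∈ devRows m σ → j ∈ devCols m σ → σ (i, j) = one := by
    intro i j hi hj
    have heq := Finset.eq_of_subset_of_card_le (filter_one_subset hm σ)
      (by rw [Finset.card_product, hmul]; exact le_rfl)
    have hij : (i, j) ∈ devRows m σ ×ˢ devCols m σ := Finset.mem_product.2 ⟨hi, hj⟩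
    rw [← heq] at hij
    exact (Finset.mem_filter.1 hij).2
  have hrow : ∀ i ∈ devRows m σ, ∀ j, σ (i, j) = one ↔ j ∈ devCols m σ := fun i hi j =>
    ⟨fun h => mem_devCols.2 ⟨i, by rw [h]; exact hm.symm⟩, hfill i j hi⟩
  have hcol : ∀ j ∈ devCols m σ, ∀ i, σ (i, j) = one ↔ i ∈ devRows m σ := fun j hj i =>
    ⟨fun h => mem_devRows.2 ⟨j, by rw [h]; exact hm.symm⟩, fun hi => hfill i j hi hj⟩
  have hval : ∀ v : Site K L, σ v = one ∨ σ v = m := by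
    rintro ⟨i, j⟩
    by_cases hi : i ∈ devRows m σ
    · by_cases hj : j ∈ devCols m σ
      · exact .inl (hfill i j hi hj)
      · exact .inr (not_not.1 fun h => hj (mem_devCols.2 ⟨i, h⟩))
    · exact .inr (not_not.1 fun h => hi (mem_devRows.2 ⟨j, h⟩))
  have hiff : ∀ u v : Site K L, σ u = σ v ↔ (σ u = one) = (σ v = one) := by
    intro u v
    rcases hval u with hu | hu <;> rcases hval v with hv | hv <;> simp [hu, hv, hm, hm.symm]
  have hbrow : ∀ i ∈ devRows m σ, (bdry fun j => σ (i, j)) = bdry fun j => j ∈ devCols m σ :=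
    fun i hi => bdry_congr fun x y => by rw [hiff, hrow i hi, hrow i hi]
  have hbcol : ∀ j ∈ devCols m σ, (bdry fun i => σ (i, j)) = bdry fun i => i ∈ devRows m σ :=
    fun j hj => bdry_congr fun x y => by rw [hiff, hcol j hj, hcol j hj]
  have hbr : breaks σ < 4 * l := by
    have h1 : (breaks σ : ℝ) ≤ barrier h l + h * (l * (l - 1)) := by
      rw [excess, hones, cast_mul_pred hl.three_le] at hE
      linarith
    have h2 := hl.pos
    rw [barrier] at h1
    have h3 : (breaks σ : ℝ) < 4 * l := by linarith
    exact_mod_cast h3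
  have h3 := hl.three_le
  have hRne : (devRows m σ).Nonempty := Finset.card_pos.1 (by omega)
  have hCne : (devCols m σ).Nonempty := Finset.card_pos.1 (by omega)
  have htwo := breaks_ge_of_bdry_ge (m := m) (σ := σ) (fun i hi => (hbrow i hi).ge)
    (fun j hj => (hbcol j hj).ge)
  have hR2 : 2 ≤ bdry fun i => i ∈ devRows m σ := by
    obtain ⟨i₀, hi₀⟩ := hσ.exists_row
    obtain ⟨i, hi⟩ := hRne
    refine two_le_bdry (x := i) (y := i₀) ?_
    simp [hi, mem_devRows, hi₀]
  have hC2 : 2 ≤ bdry fun j => j ∈ devCols m σ := by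
    obtain ⟨j₀, hj₀⟩ := hσ.exists_col
    obtain ⟨j, hj⟩ := hCne
    refine two_le_bdry (x := j) (y := j₀) ?_
    simp [hj, mem_devCols, hj₀]
  -- a row or column pattern with four boundary edges would cost `2 * (l - 1)` more edges
  refine ⟨hcard, hfill, eq_arc_of_bdry_lt_four hRne hσ.1 ?_, eq_arc_of_bdry_lt_four hCne hσ.2 ?_⟩
  · by_contra! hge
    have h4 := Nat.mul_le_mul_left (devRows m σ).card hC2
    have h5 := Nat.mul_le_mul_left (devCols m σ).card hge
    omega
  · by_contra! hge
    have h4 := Nat.mul_le_mul_left (devRows m σ).card hge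
    have h5 := Nat.mul_le_mul_left (devCols m σ).card hR2
    omega

end Potts

namespace Potts

/-! ### Crossing the barrier -/

variable {K L q : ℕ}

theorem mem_rect {p v : Site K L} {a b : ℕ} :
    v ∈ rect p a b ↔ v.1 ∈ arc p.1 a ∧ v.2 ∈ arc p.2 b := by
  rw [mem_arc, mem_arc]
  constructor
  · rintro ⟨i, hi, j, hj, rfl⟩
    exact ⟨⟨i, hi, rfl⟩, ⟨j, hj, rfl⟩⟩
  · rintro ⟨⟨i, hi, hi'⟩, ⟨j, hj, hj'⟩⟩
    exact ⟨i, hi, j, hj, Prod.ext hi' hj'⟩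

theorem rect_one_one (p : Site K L) : rect p 1 1 = {p} := by
  ext v
  simp [mem_rect, mem_arc, Prod.ext_iff]

variable [NeZero K] [NeZero L]

theorem devRows_subset_insert {m : Fin q} {σ τ : Config K L q} {v : Site K L}
    (hv : ∀ u, u ≠ v → σ u = τ u) : devRows m τ ⊆ insert v.1 (devRows m σ) := by
  intro i hi
  obtain ⟨j, hj⟩ := mem_devRows.1 hi
  rw [Finset.mem_insert]
  by_cases h : (i, j) = v
  · exact .inl (congrArg Prod.fst h)
  · exact .inr (mem_devRows.2 ⟨j, by rwa [hv _ h]⟩)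

theorem devCols_subset_insert {m : Fin q} {σ τ : Config K L q} {v : Site K L}
    (hv : ∀ u, u ≠ v → σ u = τ u) : devCols m τ ⊆ insert v.2 (devCols m σ) := by
  intro j hj
  obtain ⟨i, hi⟩ := mem_devCols.1 hj
  rw [Finset.mem_insert]
  by_cases h : (i, j) = v
  · exact .inl (congrArg Prod.snd h)
  · exact .inr (mem_devCols.2 ⟨i, by rwa [hv _ h]⟩)

theorem dev_subset_of_flip_ne {m : Fin q} {σ τ : Config K L q} {v : Site K L}
    (hv : ∀ u, u ≠ v → σ u = τ u) (hτ : τ v ≠ m) :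
    devRows m σ ⊆ devRows m τ ∧ devCols m σ ⊆ devCols m τ := by
  have key : ∀ u, σ u ≠ m → τ u ≠ m := fun u hu => by
    by_cases h : u = v
    · rwa [h]
    · rwa [← hv u h]
  constructor
  · intro i hi
    obtain ⟨j, hj⟩ := mem_devRows.1 hi
    exact mem_devRows.2 ⟨j, key _ hj⟩
  · intro j hj
    obtain ⟨i, hi⟩ := mem_devCols.1 hj
    exact mem_devCols.2 ⟨i, key _ hi⟩

/-- A spin flip moves the sets of the deviating rows and columns in the same direction. -/
theorem dev_subset_or_subset {m : Fin q} {σ τ : Config K L q} {v : Site K L}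
    (hv : ∀ u, u ≠ v → σ u = τ u) :
    (devRows m σ ⊆ devRows m τ ∧ devCols m σ ⊆ devCols m τ) ∨
      (devRows m τ ⊆ devRows m σ ∧ devCols m τ ⊆ devCols m σ) := by
  by_cases hτ : τ v = m
  · by_cases hσ : σ v = m
    · obtain rfl : σ = τ := funext fun u => by
        by_cases h : u = v
        · rw [h, hσ, hτ]
        · exact hv u h
      exact .inl ⟨subset_rfl, subset_rfl⟩
    · exact .inr (dev_subset_of_flip_ne (fun u hu => (hv u hu).symm) hσ)
  · exact .inl (dev_subset_of_flip_ne hv hτ)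

theorem HasBackground.of_flip {l : ℕ} (hl : 3 ≤ l) (hK : 3 * l ≤ K) (hL : 3 * l ≤ L) {m : Fin q}
    {σ τ : Config K L q} {v : Site K L} (hv : ∀ u, u ≠ v → σ u = τ u)
    (hcard : (devRows m σ).card + (devCols m σ).card ≤ 2 * l) : HasBackground m τ := by
  constructor
  · intro h
    have h1 := (Finset.card_le_card (devRows_subset_insert (m := m) hv)).trans
      (Finset.card_insert_le _ _)
    rw [h, Finset.card_univ, ZMod.card] at h1
    omega
  · intro h
    have h1 := (Finset.card_le_card (devCols_subset_insert (m := m) hv)).trans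
      (Finset.card_insert_le _ _)
    rw [h, Finset.card_univ, ZMod.card] at h1
    omega

variable [NeZero q]

theorem ones_flip {σ τ : Config K L q} {v : Site K L} (hv : ∀ u, u ≠ v → σ u = τ u) :
    ones τ ≤ ones σ + 1 ∧ (ones σ < ones τ → τ v = one ∧ σ v ≠ one) := by
  classical
  have hsub : (Finset.univ.filter fun u => τ u = one) ⊆
      insert v (Finset.univ.filter fun u => σ u = one) := by
    intro u hu
    by_cases h : u = v
    · simp [h]
    · have : τ u = one := (Finset.mem_filter.1 hu).2
      simp [hv u h, this]
  refine ⟨(Finset.card_le_card hsub).trans (Finset.card_insert_le _ _), fun hlt => ?_⟩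
  by_contra hcon
  refine hlt.not_ge (Finset.card_le_card fun u hu => ?_)
  have hu' : τ u = one := (Finset.mem_filter.1 hu).2
  refine Finset.mem_filter.2 ⟨Finset.mem_univ u, ?_⟩
  by_cases h : u = v
  · subst h
    by_contra hne
    exact hcon ⟨hu', hne⟩
  · rw [hv u h, hu']

/-- The configurations with background `m` that have not crossed the barrier: those with at most
`l * (l - 1)` spins `one`, and those whose deviations fit in a box with sides `l - 1` and `l + 1`.
The latter are the dead ends entered by adding a site to a short side of the rectangle. -/
def subcritical (l : ℕ) (m : Fin q) : Set (Config K L q) :=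
  {σ | HasBackground m σ ∧ (ones σ ≤ l * (l - 1) ∨
    ((devRows m σ).card = l - 1 ∧ (devCols m σ).card = l + 1) ∨
    ((devRows m σ).card = l + 1 ∧ (devCols m σ).card = l - 1))}

theorem pred_mul_succ {l : ℕ} (hl : 3 ≤ l) : (l - 1) * (l + 1) + 1 = l * l := by
  obtain ⟨k, rfl⟩ : ∃ k, l = k + 1 := ⟨l - 1, by omega⟩
  simp only [Nat.add_sub_cancel]
  ring

theorem ones_lt_of_subcritical {l : ℕ} (hl : 3 ≤ l) {m : Fin q} (hm : m ≠ one)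
    {σ : Config K L q} (hσ : σ ∈ subcritical l m) : ones σ < l * l := by
  have h1 := pred_mul_succ hl
  rcases hσ.2 with h | ⟨hr, hc⟩ | ⟨hr, hc⟩
  · have : l * (l - 1) < l * l := Nat.mul_lt_mul_of_pos_left (by omega) (by omega)
    omega
  · have := ones_le_mul hm σ
    rw [hr, hc] at this
    omega
  · have := ones_le_mul hm σ
    rw [hr, hc, mul_comm] at this
    omega

/-- The subcritical configurations below the barrier do not have less energy than the constant
configuration `m`. -/
theorem excess_nonneg_of_subcritical {h : ℝ} {l : ℕ} (hl : IsCritical h l) {m : Fin q}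
    (hm : m ≠ one) {σ : Config K L q} (hσ : σ ∈ subcritical l m) (hE : excess h σ ≤ barrier h l) :
    0 ≤ excess h σ := by
  have h1 := hσ.1.card_add_card_le hl (ones_lt_of_subcritical hl.three_le hm hσ).le hE
  have h2 := hσ.1.excess_ge (h := h)
  have h3 : (ones σ : ℝ) ≤ (devRows m σ).card * (devCols m σ).card := by
    exact_mod_cast ones_le_mul hm σ
  have h4 : ((devRows m σ).card + (devCols m σ).card : ℝ) ≤ 2 * l := by exact_mod_cast h1
  have h5 := hl.shrink
  have h6 := hl.lt_one
  have h7 := hl.pos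
  set r : ℝ := ((devRows m σ).card : ℝ)
  set c : ℝ := ((devCols m σ).card : ℝ)
  have hr : 0 ≤ r := Nat.cast_nonneg _
  have hc : 0 ≤ c := Nat.cast_nonneg _
  have h8 : h * (r + c) ≤ 8 := by nlinarith
  have h9 : h * ones σ ≤ h * (r * c) := mul_le_mul_of_nonneg_left h3 h7.le
  have h10 : h * (4 * (r * c)) ≤ h * (r + c) ^ 2 :=
    mul_le_mul_of_nonneg_left (by nlinarith [sq_nonneg (r - c)]) h7.le
  have h11 : (h * (r + c)) * (r + c) ≤ 8 * (r + c) :=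
    mul_le_mul_of_nonneg_right h8 (by positivity)
  nlinarith

/-- Boxes of half perimeter at most `2 * l` that contain more than `l * (l - 1)` sites and are
comparable with a box with sides `l - 1` and `l + 1` coincide with it. -/
theorem box_rigid {l r c r' c' : ℕ} (hl : 3 ≤ l) (hsum : r' + c' ≤ 2 * l)
    (hmul : l * (l - 1) < r' * c') (hcmp : (r ≤ r' ∧ c ≤ c') ∨ (r' ≤ r ∧ c' ≤ c))
    (hrc : (r = l - 1 ∧ c = l + 1) ∨ (r = l + 1 ∧ c = l - 1)) : r' = r ∧ c' = c := by
  obtain ⟨k, rfl⟩ : ∃ k, l = k + 1 := ⟨l - 1, by omega⟩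
  simp only [Nat.add_sub_cancel] at *
  have hsum' : 2 * k + 2 ≤ r' + c' := by
    by_contra! hlt
    have h1 : (r' : ℤ) + c' ≤ 2 * k + 1 := by omega
    have h2 : ((k : ℤ) + 1) * k < r' * c' := by exact_mod_cast hmul
    nlinarith [sq_nonneg ((r' : ℤ) - c')]
  omega

/-- A new site `one` without a neighbour `one` costs `4 - h`, which is too much next to the barrier. -/
theorem exists_neighbor_one {h : ℝ} {l : ℕ} (hK : 2 ≤ K) (hL : 2 ≤ L) {m : Fin q} (hm : m ≠ one)
    {σ τ : Config K L q} {v : Site K L}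
    (hv : ∀ u, u ≠ v → σ u = τ u) (hσv : σ v = m) (hτv : τ v = one)
    (hσ : ∀ u, σ u = one ∨ σ u = m)
    (hlow : barrier h l < excess h σ + 4 - h) (hE : excess h τ ≤ barrier h l) :
    σ (v - (1, 0)) = one ∨ σ (v + (1, 0)) = one ∨ σ (v - (0, 1)) = one ∨
      σ (v + (0, 1)) = one := by
  classical
  by_contra! hno
  obtain ⟨h1, h2, h3, h4⟩ := hno
  have hτ : τ = Function.update σ v one := funext fun u => by
    by_cases hu : u = v
    · rw [hu, hτv, Function.update_self]
    · rw [Function.update_of_ne hu, hv u hu]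
  have hup := excess_update hK hL h σ v one
  rw [← hτ, (hσ _).resolve_left h1, (hσ _).resolve_left h2, (hσ _).resolve_left h3,
    (hσ _).resolve_left h4, hσv, dis_self, dis_of_ne hm, if_pos rfl, if_neg hm] at hup
  linarith

/-- The step over the barrier: from a subcritical configuration, a spin flip below the barrier leads
to a subcritical configuration or to a critical droplet. -/
theorem subcritical_step {h : ℝ} {l : ℕ} (hl : IsCritical h l) (hK : 3 * l ≤ K) (hL : 3 * l ≤ L)
    {m : Fin q} (hm : m ≠ one) {σ τ : Config K L q} (hσ : σ ∈ subcritical l m)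
    (hEσ : excess h σ ≤ barrier h l) (hEτ : excess h τ ≤ barrier h l)
    (hadj : (flipGraph K L q).Adj σ τ) :
    τ ∈ subcritical l m ∨ τ ∈ barB (l - 1) l 1 m one := by
  have h3 := hl.three_le
  obtain ⟨v, hne, hv⟩ := flipGraph_adj.1 hadj
  have hones := ones_lt_of_subcritical h3 hm hσ
  have hsumσ := hσ.1.card_add_card_le hl hones.le hEσ
  have hτ : HasBackground m τ := .of_flip h3 hK hL hv hsumσ
  have hflip := ones_flip hv
  by_cases hτl : ones τ ≤ l * (l - 1)
  · exact .inl ⟨hτ, .inl hτl⟩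
  push Not at hτl
  have hsumτ := hτ.card_add_card_le hl (by omega) hEτ
  have hmulτ := hτl.trans_le (ones_le_mul hm τ)
  have hcmp : ((devRows m σ).card ≤ (devRows m τ).card ∧ (devCols m σ).card ≤ (devCols m τ).card) ∨
      ((devRows m τ).card ≤ (devRows m σ).card ∧ (devCols m τ).card ≤ (devCols m σ).card) :=
    (dev_subset_or_subset (m := m) hv).imp
      (fun h => ⟨Finset.card_le_card h.1, Finset.card_le_card h.2⟩)
      (fun h => ⟨Finset.card_le_card h.1, Finset.card_le_card h.2⟩)
  rcases hσ.2 with hn | hbox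
  swap
  · obtain ⟨h1, h2⟩ := box_rigid h3 hsumτ hmulτ hcmp hbox
    rw [← h1, ← h2] at hbox
    exact .inl ⟨hτ, .inr hbox⟩
  have hn' : ones σ = l * (l - 1) := by omega
  obtain ⟨hτv, hσv⟩ := hflip.2 (by omega)
  obtain ⟨hcard, hfill, ⟨a, ha⟩, ⟨b, hb⟩⟩ := hσ.1.eq_rect hl hm hn' hEσ
  have hout : ∀ u : Site K L, ¬(u.1 ∈ devRows m σ ∧ u.2 ∈ devCols m σ) → σ u = m := by
    intro u hu
    by_contra hum
    exact hu ⟨mem_devRows.2 ⟨u.2, hum⟩, mem_devCols.2 ⟨u.1, hum⟩⟩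
  have hin : ∀ u : Site K L, σ u = one → u.1 ∈ devRows m σ ∧ u.2 ∈ devCols m σ := by
    intro u hu
    by_contra hcon
    exact hm ((hout u hcon).symm.trans hu)
  have hval : ∀ u, σ u = one ∨ σ u = m := fun u => by
    by_cases hu : u.1 ∈ devRows m σ ∧ u.2 ∈ devCols m σ
    · exact .inl (hfill _ _ hu.1 hu.2)
    · exact .inr (hout u hu)
  have hvm := (hval v).resolve_left hσv
  have hvout : ¬(v.1 ∈ devRows m σ ∧ v.2 ∈ devCols m σ) := fun hcon =>
    hσv (hfill _ _ hcon.1 hcon.2)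
  have hlow : barrier h l < excess h σ + 4 - h := by
    have h1 := hσ.1.excess_ge (h := h)
    rw [hn', cast_mul_pred h3] at h1
    have h2 : ((devRows m σ).card + (devCols m σ).card : ℝ) = 2 * l - 1 := by
      have h3 : (devRows m σ).card + (devCols m σ).card + 1 = 2 * l := by omega
      have h4 : ((devRows m σ).card + (devCols m σ).card + 1 : ℝ) = 2 * l := by exact_mod_cast h3
      linarith
    rw [h2] at h1
    rw [barrier]
    linarith
  have hnb := exists_neighbor_one (by omega) (by omega) hm hv hvm hτv hval hlow hEτ
  have hτ1 : ∀ u : Site K L, u.1 ∈ devRows m σ → u.2 ∈ devCols m σ → τ u = one := fun u h1 h2 => by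
    rw [← hv u fun huv => hvout (huv ▸ ⟨h1, h2⟩)]
    exact hfill _ _ h1 h2
  have hτm : ∀ u : Site K L, u ≠ v → ¬(u.1 ∈ devRows m σ ∧ u.2 ∈ devCols m σ) → τ u = m :=
    fun u h1 h2 => by rw [← hv u h1]; exact hout u h2
  -- the shape of `τ`, once the set `D` of the spins `one` is identified
  have hshape : ∀ (p : Site K L) (x y : ℕ), devRows m σ = arc p.1 x → devCols m σ = arc p.2 y →
      IsRectWithBar (l - 1) l 1 (rect p x y ∪ {v}) → τ ∈ barB (l - 1) l 1 m one := by
    intro p x y h1 h2 hD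
    rw [h1, h2] at hτ1 hτm
    refine ⟨_, hD, ?_, ?_⟩
    · rintro u (hu | rfl)
      · exact hτ1 u (mem_rect.1 hu).1 (mem_rect.1 hu).2
      · exact hτv
    · intro u hu
      rw [Set.mem_union, not_or, mem_rect] at hu
      exact hτm u hu.2 hu.1
  have hdev := dev_subset_of_flip_ne hv (by rw [hτv]; exact hm.symm : τ v ≠ m)
  have hle1 := Finset.card_le_card hdev.1
  have hle2 := Finset.card_le_card hdev.2
  -- the new site extends the rectangle by a row
  have hcaseR : v.2 ∈ devCols m σ → (v.1 = a - 1 ∨ v.1 = a + ((devRows m σ).card : ZMod K)) →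
      τ ∈ subcritical l m ∨ τ ∈ barB (l - 1) l 1 m one := by
    intro hv2 hv1
    have hv1' : v.1 ∉ devRows m σ := fun hcon => hvout ⟨hcon, hv2⟩
    have hlt : (devRows m σ).card < (devRows m τ).card := Finset.card_lt_card
      ⟨hdev.1, fun hcon => hv1' (hcon (mem_devRows.2 ⟨v.2, by rw [hτv]; exact hm.symm⟩))⟩
    rcases hcard with ⟨hr, hc⟩ | ⟨hr, hc⟩
    · right
      rw [hr] at ha hv1
      rw [hc] at hb
      refine hshape (a, b) _ _ ha hb ?_
      rw [hb, mem_arc] at hv2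
      obtain ⟨k, hk, hk'⟩ := hv2
      refine ⟨(a, b), k, by omega, ?_⟩
      rcases hv1 with hv1 | hv1
      · refine .inl ?_
        rw [rect_one_one, Prod.mk_add_mk]
        congr 2
        exact Prod.ext (by rw [hv1]; ring) hk'
      · refine .inr (.inl ?_)
        rw [rect_one_one, Prod.mk_add_mk]
        congr 2
        exact Prod.ext hv1 hk'
    · exact .inl ⟨hτ, .inr (.inr (by omega))⟩
  -- the new site extends the rectangle by a column
  have hcaseC : v.1 ∈ devRows m σ → (v.2 = b - 1 ∨ v.2 = b + ((devCols m σ).card : ZMod L)) →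
      τ ∈ subcritical l m ∨ τ ∈ barB (l - 1) l 1 m one := by
    intro hv1 hv2
    have hv2' : v.2 ∉ devCols m σ := fun hcon => hvout ⟨hv1, hcon⟩
    have hlt : (devCols m σ).card < (devCols m τ).card := Finset.card_lt_card
      ⟨hdev.2, fun hcon => hv2' (hcon (mem_devCols.2 ⟨v.1, by rw [hτv]; exact hm.symm⟩))⟩
    rcases hcard with ⟨hr, hc⟩ | ⟨hr, hc⟩
    · exact .inl ⟨hτ, .inr (.inl (by omega))⟩
    · right
      rw [hr] at ha
      rw [hc] at hb hv2
      refine hshape (a, b) _ _ ha hb ?_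
      rw [ha, mem_arc] at hv1
      obtain ⟨k, hk, hk'⟩ := hv1
      refine ⟨(a, b), k, by omega, ?_⟩
      rcases hv2 with hv2 | hv2
      · refine .inr (.inr (.inl ?_))
        rw [rect_one_one, Prod.mk_add_mk]
        congr 2
        exact Prod.ext hk' (by rw [hv2]; ring)
      · refine .inr (.inr (.inr ?_))
        rw [rect_one_one, Prod.mk_add_mk]
        congr 2
        exact Prod.ext hk' hv2
  rcases hnb with hu | hu | hu | hu
  · obtain ⟨hu1, hu2⟩ := hin _ hu
    simp only [Prod.fst_sub, Prod.snd_sub, sub_zero] at hu1 hu2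
    have hnot : v.1 ∉ devRows m σ := fun hcon => hvout ⟨hcon, hu2⟩
    rw [ha] at hu1 hnot
    exact hcaseR hu2 (.inr (eq_add_of_notMem_arc hnot hu1))
  · obtain ⟨hu1, hu2⟩ := hin _ hu
    simp only [Prod.fst_add, Prod.snd_add, add_zero] at hu1 hu2
    have hnot : v.1 ∉ devRows m σ := fun hcon => hvout ⟨hcon, hu2⟩
    rw [ha] at hu1 hnot
    exact hcaseR hu2 (.inl (eq_sub_of_notMem_arc hnot hu1))
  · obtain ⟨hu1, hu2⟩ := hin _ hu
    simp only [Prod.fst_sub, Prod.snd_sub, sub_zero] at hu1 hu2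
    have hnot : v.2 ∉ devCols m σ := fun hcon => hvout ⟨hu1, hcon⟩
    rw [hb] at hu2 hnot
    exact hcaseC hu1 (.inr (eq_add_of_notMem_arc hnot hu2))
  · obtain ⟨hu1, hu2⟩ := hin _ hu
    simp only [Prod.fst_add, Prod.snd_add, add_zero] at hu1 hu2
    have hnot : v.2 ∉ devCols m σ := fun hcon => hvout ⟨hu1, hcon⟩
    rw [hb] at hu2 hnot
    exact hcaseC hu1 (.inl (eq_sub_of_notMem_arc hnot hu2))

theorem const_mem_subcritical {l : ℕ} {m : Fin q} (hm : m ≠ one) :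
    (const m : Config K L q) ∈ subcritical l m := by
  refine ⟨⟨fun h => ?_, fun h => ?_⟩, .inl ?_⟩
  · exact absurd (h ▸ Finset.mem_univ (0 : ZMod K)) (by simp [mem_devRows, const])
  · exact absurd (h ▸ Finset.mem_univ (0 : ZMod L)) (by simp [mem_devCols, const])
  · simp [ones, const, hm]

theorem const_one_notMem_subcritical {l : ℕ} {m : Fin q} (hm : m ≠ one) :
    (const one : Config K L q) ∉ subcritical l m := by
  rintro ⟨⟨h, -⟩, -⟩
  refine h (Finset.eq_univ_iff_forall.2 fun i => mem_devRows.2 ⟨0, ?_⟩)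
  exact hm.symm

/-- The critical droplets separate the subcritical configurations from all others. -/
theorem exists_mem_barB {h : ℝ} {l : ℕ} (hl : IsCritical h l) (hK : 3 * l ≤ K) (hL : 3 * l ≤ L)
    {m : Fin q} (hm : m ≠ one) {τ : Config K L q} (hτ : τ ∉ subcritical l m)
    (p : (flipGraph K L q).Walk (const m) τ)
    (hp : ∀ z ∈ p.support, excess h z ≤ barrier h l) :
    ∃ z ∈ p.support, z ∈ barB (l - 1) l 1 m one :=
  Landscape.exists_mem_of_step (P := {z | excess h z ≤ barrier h l})
    (fun _ _ hσ hτ hsub hadj => subcritical_step hl hK hL hm hsub hσ hτ hadj) p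
    (const_mem_subcritical hm) hτ hp

end Potts

namespace Potts

open Landscape

/-! ### Transposition of the torus -/

section Transpose

variable {K L q : ℕ}

/-- The configuration on the torus with the rows and the columns exchanged. -/
def transpose (σ : Config K L q) : Config L K q := fun v => σ v.swap

variable [NeZero K] [NeZero L]

theorem flipGraph_adj_transpose {σ τ : Config K L q} (hadj : (flipGraph K L q).Adj σ τ) :
    (flipGraph L K q).Adj (transpose σ) (transpose τ) := by
  obtain ⟨v, hv, hu⟩ := flipGraph_adj.1 hadj
  refine flipGraph_adj.2 ⟨v.swap, hv, fun u huv => hu _ fun h => huv ?_⟩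
  rw [← h, Prod.swap_swap]

theorem excess_transpose [NeZero q] (h : ℝ) (σ : Config K L q) :
    excess h (transpose σ) = excess h σ := by
  have h1 : breaks (transpose σ) = breaks σ := add_comm _ _
  have h2 : (ones (transpose σ) : ℝ) = ones σ := by
    rw [cast_ones, cast_ones]
    exact Equiv.sum_comp (Equiv.prodComm (ZMod L) (ZMod K))
      fun v => if σ v = one then (1 : ℝ) else 0
  rw [excess, excess, h1, h2]

theorem joinedIn_transpose {P : Set (Config K L q)} {Q : Set (Config L K q)}
    (hPQ : ∀ σ ∈ P, transpose σ ∈ Q) {σ τ : Config K L q}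
    (hστ : JoinedIn (flipGraph K L q) P σ τ) :
    JoinedIn (flipGraph L K q) Q (transpose σ) (transpose τ) :=
  hστ.map ⟨transpose, flipGraph_adj_transpose⟩ hPQ

end Transpose

/-! ### Growing droplets -/

variable {K L q : ℕ} [NeZero q]

open Classical in
/-- The configuration with the spins `one` on `D` and `m` elsewhere. -/
def mark (m : Fin q) (D : Set (Site K L)) : Config K L q := fun v => if v ∈ D then one else m

theorem mark_of_mem {m : Fin q} {D : Set (Site K L)} {v : Site K L} (hv : v ∈ D) :
    mark m D v = one := if_pos hv

theorem mark_of_notMem {m : Fin q} {D : Set (Site K L)} {v : Site K L} (hv : v ∉ D) :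
    mark m D v = m := if_neg hv

theorem mark_insert (m : Fin q) (D : Set (Site K L)) (v : Site K L) :
    mark m (D ∪ {v}) = Function.update (mark m D) v one := by
  ext1 u
  by_cases hu : u = v
  · rw [hu, Function.update_self, mark_of_mem (by simp)]
  · rw [Function.update_of_ne hu]
    by_cases hD : u ∈ D
    · rw [mark_of_mem hD, mark_of_mem (.inl hD)]
    · rw [mark_of_notMem hD, mark_of_notMem (by simp [hu, hD])]

theorem transpose_mark_rect (m : Fin q) (p : Site K L) (a b : ℕ) :
    transpose (mark m (rect p a b)) = mark m (rect p.swap b a) := by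
  ext1 u
  have : u.swap ∈ rect p a b ↔ u ∈ rect p.swap b a := by
    rw [mem_rect, mem_rect]; exact and_comm
  by_cases hu : u ∈ rect p.swap b a
  · rw [mark_of_mem hu, transpose, mark_of_mem (this.2 hu)]
  · rw [mark_of_notMem hu, transpose, mark_of_notMem (mt this.1 hu)]

theorem mark_empty (m : Fin q) : mark m (∅ : Set (Site K L)) = const m := by
  ext1 u
  exact mark_of_notMem (Set.notMem_empty u)

open Classical in
/-- The configuration obtained from `σ` by setting to `one` the first `k` sites of the row of `v`,
counted from `v` in the direction `e` (which is `1` or `-1`). -/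
def fillRow (σ : Config K L q) (v : Site K L) (e : ZMod L) (k : ℕ) : Config K L q :=
  fun u => if ∃ i < k, u = v + (0, i * e) then one else σ u

theorem fillRow_zero (σ : Config K L q) (v : Site K L) (e : ZMod L) : fillRow σ v e 0 = σ := by
  ext1 u
  simp [fillRow]

theorem fillRow_of_eq_one {σ : Config K L q} {u : Site K L} (hu : σ u = one) (v : Site K L)
    (e : ZMod L) (k : ℕ) : fillRow σ v e k u = one := by
  unfold fillRow
  split_ifs
  exacts [rfl, hu]

theorem fillRow_succ (σ : Config K L q) (v : Site K L) (e : ZMod L) (k : ℕ) :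
    fillRow σ v e (k + 1) = Function.update (fillRow σ v e k) (v + (0, k * e)) one := by
  ext1 u
  by_cases hu : u = v + (0, k * e)
  · rw [hu, Function.update_self]
    exact if_pos ⟨k, by omega, rfl⟩
  · rw [Function.update_of_ne hu]
    unfold fillRow
    have : (∃ i < k + 1, u = v + (0, i * e)) ↔ ∃ i < k, u = v + (0, i * e) := by
      constructor
      · rintro ⟨i, hi, hiu⟩
        refine ⟨i, lt_of_le_of_ne (by omega) fun hik => hu (hik ▸ hiu), hiu⟩
      · rintro ⟨i, hi, hiu⟩
        exact ⟨i, by omega, hiu⟩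
    simp only [this]

theorem fillRow_apply_add {σ : Config K L q} {v : Site K L} {e : ZMod L} (he : e = 1 ∨ e = -1)
    {k : ℕ} (hk : k < L) : fillRow σ v e k (v + (0, k * e)) = σ (v + (0, k * e)) := by
  refine if_neg ?_
  rintro ⟨i, hi, h⟩
  have h1 : (k : ZMod L) * e = i * e := congrArg Prod.snd (add_left_cancel h)
  have h2 : (k : ZMod L) = i := by
    rcases he with rfl | rfl
    · simpa using h1
    · simpa using h1
  have := natCast_inj_of_lt hk (by omega) h2
  omega

theorem mem_arc_succ {n : ℕ} {a x : ZMod n} {t : ℕ} :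
    x ∈ arc a (t + 1) ↔ x ∈ arc a t ∨ x = a + (t : ZMod n) := by
  rw [mem_arc, mem_arc]
  constructor
  · rintro ⟨i, hi, rfl⟩
    rcases Nat.lt_succ_iff_lt_or_eq.1 hi with h | rfl
    exacts [.inl ⟨i, h, rfl⟩, .inr rfl]
  · rintro (⟨i, hi, rfl⟩ | rfl)
    exacts [⟨i, by omega, rfl⟩, ⟨t, by omega, rfl⟩]

theorem fillRow_mark_rect (m : Fin q) (p : Site K L) (a b : ℕ) :
    fillRow (mark m (rect p a b)) (p + ((a : ZMod K), 0)) 1 b = mark m (rect p (a + 1) b) := by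
  have key : ∀ u : Site K L, u ∈ rect p (a + 1) b ↔
      (∃ i < b, u = p + ((a : ZMod K), 0) + (0, (i : ZMod L) * 1)) ∨ u ∈ rect p a b := by
    intro u
    rw [mem_rect, mem_rect, mem_arc_succ, or_and_right, or_comm]
    refine or_congr_left ?_
    rw [mem_arc]
    constructor
    · rintro ⟨h1, i, hi, h2⟩
      exact ⟨i, hi, Prod.ext (by simpa using h1) (by simpa using h2)⟩
    · rintro ⟨i, hi, rfl⟩
      exact ⟨by simp, i, hi, by simp⟩
  ext1 u
  unfold fillRow
  split_ifs with hu
  · rw [mark_of_mem ((key u).2 (.inl hu))]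
  · by_cases hr : u ∈ rect p a b
    · rw [mark_of_mem hr, mark_of_mem ((key u).2 (.inr hr))]
    · rw [mark_of_notMem hr, mark_of_notMem fun hcon => ((key u).1 hcon).elim hu hr]

theorem eq_mark {m : Fin q} {D : Set (Site K L)} {w : Config K L q} (h1 : ∀ v ∈ D, w v = one)
    (hm : ∀ v ∉ D, w v = m) : w = mark m D := by
  ext1 v
  by_cases hv : v ∈ D
  · rw [h1 v hv, mark_of_mem hv]
  · rw [hm v hv, mark_of_notMem hv]

theorem transpose_mark_rect_insert (m : Fin q) (p v : Site K L) (a b : ℕ) :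
    transpose (mark m (rect p a b ∪ {v})) = mark m (rect p.swap b a ∪ {v.swap}) := by
  rw [mark_insert, mark_insert, ← transpose_mark_rect]
  ext1 u
  unfold transpose
  by_cases hu : u = v.swap
  · rw [hu, Prod.swap_swap, Function.update_self, Function.update_self]
  · rw [Function.update_of_ne hu, Function.update_of_ne fun h => hu (by rw [← h, Prod.swap_swap])]

variable [NeZero K] [NeZero L]

theorem flipGraph_adj_update {σ : Config K L q} {v : Site K L} (hv : σ v ≠ one) :
    (flipGraph K L q).Adj σ (Function.update σ v one) :=
  flipGraph_adj.2 ⟨v, by simpa using hv, fun u hu => by rw [Function.update_of_ne hu]⟩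

theorem dis_sub_dis_eq {x m : Fin q} (hm : m ≠ one) (hx : x = one) :
    dis x one - dis x m = -1 := by
  rw [hx, dis_self, dis_of_ne hm.symm]; norm_num

theorem excess_update_le_add_four (hK : 2 ≤ K) (hL : 2 ≤ L) (h : ℝ) {m : Fin q} (hm : m ≠ one)
    {σ : Config K L q} {v : Site K L} (hv : σ v = m) :
    excess h (Function.update σ v one) ≤ excess h σ + 4 - h := by
  rw [excess_update hK hL, hv, if_pos rfl, if_neg hm]
  linarith [dis_sub_dis_le (σ (v - (1, 0))) one m, dis_sub_dis_le (σ (v + (1, 0))) one m,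
    dis_sub_dis_le (σ (v - (0, 1))) one m, dis_sub_dis_le (σ (v + (0, 1))) one m]

theorem excess_update_le_add_two (hK : 2 ≤ K) (hL : 2 ≤ L) (h : ℝ) {m : Fin q} (hm : m ≠ one)
    {σ : Config K L q} {v : Site K L} (hv : σ v = m)
    (hvert : σ (v - (1, 0)) = one ∨ σ (v + (1, 0)) = one) :
    excess h (Function.update σ v one) ≤ excess h σ + 2 - h := by
  rw [excess_update hK hL, hv, if_pos rfl, if_neg hm]
  have h1 := dis_sub_dis_le (σ (v - (1, 0))) one m
  have h2 := dis_sub_dis_le (σ (v + (1, 0))) one m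
  have h3 := dis_sub_dis_le (σ (v - (0, 1))) one m
  have h4 := dis_sub_dis_le (σ (v + (0, 1))) one m
  rcases hvert with h5 | h5 <;> have h6 := dis_sub_dis_eq hm h5 <;> linarith

theorem excess_update_le_sub (hK : 2 ≤ K) (hL : 2 ≤ L) (h : ℝ) {m : Fin q} (hm : m ≠ one)
    {σ : Config K L q} {v : Site K L} (hv : σ v = m)
    (hvert : σ (v - (1, 0)) = one ∨ σ (v + (1, 0)) = one)
    (hhor : σ (v - (0, 1)) = one ∨ σ (v + (0, 1)) = one) :
    excess h (Function.update σ v one) ≤ excess h σ - h := by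
  rw [excess_update hK hL, hv, if_pos rfl, if_neg hm]
  have h1 := dis_sub_dis_le (σ (v - (1, 0))) one m
  have h2 := dis_sub_dis_le (σ (v + (1, 0))) one m
  have h3 := dis_sub_dis_le (σ (v - (0, 1))) one m
  have h4 := dis_sub_dis_le (σ (v + (0, 1))) one m
  rcases hvert with h5 | h5 <;> rcases hhor with h7 | h7 <;>
    have h6 := dis_sub_dis_eq hm h5 <;> have h8 := dis_sub_dis_eq hm h7 <;> linarith

/-- Along a row whose sites have a vertical neighbour in the droplet, only the first site may cost
energy. -/
theorem excess_fillRow_le (hK : 2 ≤ K) (hL : 2 ≤ L) {h : ℝ} {m : Fin q} (hm : m ≠ one)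
    {σ : Config K L q} {v : Site K L} {e : ZMod L} (he : e = 1 ∨ e = -1) {c : ℝ} {l : ℕ}
    (hl : l ≤ L) (hσ : ∀ k < l, σ (v + (0, k * e)) = m)
    (hvert : ∀ k < l, σ (v + (0, k * e) - (1, 0)) = one ∨ σ (v + (0, k * e) + (1, 0)) = one)
    (hfirst : excess h (fillRow σ v e 1) ≤ excess h σ + c - h) (k : ℕ) (hk : 0 < k) (hkl : k ≤ l) :
    excess h (fillRow σ v e k) ≤ excess h σ + c - h * k := by
  induction k, hk using Nat.le_induction with
  | base => simpa using hfirst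
  | succ k hk ih =>
    have h1 := ih (by omega)
    rw [fillRow_succ]
    refine (excess_update_le_sub hK hL h hm ?_ ?_ ?_).trans ?_
    · rw [fillRow_apply_add he (by omega), hσ k (by omega)]
    · exact (hvert k (by omega)).imp (fun h => fillRow_of_eq_one h ..)
        (fun h => fillRow_of_eq_one h ..)
    · have hprev : fillRow σ v e k (v + (0, (k - 1 : ℕ) * e)) = one :=
        if_pos ⟨k - 1, by omega, rfl⟩
      rw [Nat.cast_sub hk] at hprev
      rcases he with rfl | rfl
      · left
        convert hprev using 2
        ext
        · simp
        · simp; ring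
      · right
        convert hprev using 2
        ext
        · simp
        · simp; ring
    · push_cast
      linarith

theorem joinedIn_fillRow {P : Set (Config K L q)} {m : Fin q} (hm : m ≠ one)
    {σ : Config K L q} {v : Site K L} {e : ZMod L} (he : e = 1 ∨ e = -1) {l : ℕ}
    (hl : l ≤ L) (hσ : ∀ k < l, σ (v + (0, k * e)) = m)
    (hP : ∀ k ≤ l, fillRow σ v e k ∈ P) :
    JoinedIn (flipGraph K L q) P σ (fillRow σ v e l) := by
  have := JoinedIn.of_seq (G := flipGraph K L q) (fillRow σ v e) l hP fun k hk => by
    rw [fillRow_succ]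
    refine .inr (flipGraph_adj_update ?_)
    rw [fillRow_apply_add he (by omega), hσ k hk]
    exact hm
  rwa [fillRow_zero] at this

/-- Adding a row to a rectangle of spins `one`. -/
theorem add_row {h : ℝ} (h_pos : 0 < h) (hK : 2 ≤ K) (hL : 2 ≤ L) {m : Fin q} (hm : m ≠ one)
    (p : Site K L) {a b : ℕ} (ha : 1 ≤ a) (haK : a < K) (hb : 1 ≤ b) (hbL : b ≤ L) :
    excess h (mark m (rect p (a + 1) b)) ≤ excess h (mark m (rect p a b)) + 2 - h * b ∧
    ∀ c, excess h (mark m (rect p a b)) + 2 - h < c → excess h (mark m (rect p a b)) < c →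
      JoinedIn (flipGraph K L q) {z | excess h z < c} (mark m (rect p a b))
        (mark m (rect p (a + 1) b)) := by
  have hσ : ∀ k < b, mark m (rect p a b) (p + ((a : ZMod K), 0) + (0, (k : ZMod L) * 1)) = m := by
    intro k hk
    refine mark_of_notMem fun hcon => ?_
    have := (mem_rect.1 hcon).1
    simp only [Prod.fst_add, add_zero] at this
    exact add_notMem_arc le_rfl haK this
  have hvert : ∀ k < b,
      mark m (rect p a b) (p + ((a : ZMod K), 0) + (0, (k : ZMod L) * 1) - (1, 0)) = one ∨
      mark m (rect p a b) (p + ((a : ZMod K), 0) + (0, (k : ZMod L) * 1) + (1, 0)) = one := by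
    intro k hk
    refine .inl (mark_of_mem (mem_rect.2 ⟨mem_arc.2 ⟨a - 1, by omega, ?_⟩,
      mem_arc.2 ⟨k, hk, by simp⟩⟩))
    rw [Nat.cast_sub ha]
    simp only [Prod.fst_sub, Prod.fst_add, Nat.cast_one]
    ring
  have hfirst : excess h (fillRow (mark m (rect p a b)) (p + ((a : ZMod K), 0)) 1 1)
      ≤ excess h (mark m (rect p a b)) + 2 - h := by
    rw [fillRow_succ, fillRow_zero]
    exact excess_update_le_add_two hK hL h hm (hσ 0 (by omega)) (hvert 0 (by omega))
  have hle := excess_fillRow_le hK hL hm (.inl rfl) hbL hσ hvert hfirst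
  refine ⟨?_, fun c hc hc' => ?_⟩
  · rw [← fillRow_mark_rect]
    exact hle b hb le_rfl
  · rw [← fillRow_mark_rect]
    refine joinedIn_fillRow hm (.inl rfl) hbL hσ fun k hk => ?_
    rcases Nat.eq_zero_or_pos k with rfl | hk'
    · rw [fillRow_zero]; exact hc'
    · have h1 := hle k hk' hk
      have h2 : (1 : ℝ) ≤ k := by exact_mod_cast hk'
      have h3 : h * 1 ≤ h * k := mul_le_mul_of_nonneg_left h2 h_pos.le
      change excess h _ < c
      linarith

/-- Adding a column to a rectangle of spins `one`. -/
theorem add_col {h : ℝ} (h_pos : 0 < h) (hK : 2 ≤ K) (hL : 2 ≤ L) {m : Fin q} (hm : m ≠ one)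
    (p : Site K L) {a b : ℕ} (ha : 1 ≤ a) (haK : a ≤ K) (hb : 1 ≤ b) (hbL : b < L) :
    excess h (mark m (rect p a (b + 1))) ≤ excess h (mark m (rect p a b)) + 2 - h * a ∧
    ∀ c, excess h (mark m (rect p a b)) + 2 - h < c → excess h (mark m (rect p a b)) < c →
      JoinedIn (flipGraph K L q) {z | excess h z < c} (mark m (rect p a b))
        (mark m (rect p a (b + 1))) := by
  have h1 := add_row h_pos hL hK hm p.swap hb hbL ha haK
  have h2 : ∀ x y, mark m (rect p x y) = transpose (mark m (rect p.swap y x)) := fun x y => by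
    rw [transpose_mark_rect, Prod.swap_swap]
  rw [h2 a b, h2 a (b + 1), excess_transpose, excess_transpose]
  refine ⟨h1.1, fun c hc hc' => joinedIn_transpose (fun σ hσ => ?_) (h1.2 c hc hc')⟩
  change excess h _ < c
  rw [excess_transpose]
  exact hσ

theorem mark_rect_univ (m : Fin q) (p : Site K L) : mark m (rect p K L) = const one := by
  ext1 u
  refine mark_of_mem (mem_rect.2 ⟨mem_arc.2 (exists_eq_add_natCast _ _), mem_arc.2 ?_⟩)
  exact exists_eq_add_natCast _ _

/-- The first site of a droplet. -/
theorem add_site {h : ℝ} (hK : 2 ≤ K) (hL : 2 ≤ L) {m : Fin q} (hm : m ≠ one) (p : Site K L) :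
    excess h (mark m (rect p 1 1)) ≤ 4 - h ∧
      (flipGraph K L q).Adj (const m) (mark m (rect p 1 1)) := by
  have h1 : mark m (rect p 1 1) = Function.update (const m) p one := by
    rw [rect_one_one, ← mark_empty, ← mark_insert, Set.empty_union]
  rw [h1]
  refine ⟨?_, flipGraph_adj_update hm⟩
  have := excess_update_le_add_four hK hL h hm (σ := const m) (v := p) rfl
  rwa [excess_const h hm, zero_add] at this

theorem excess_rect_le {h : ℝ} (h_pos : 0 < h) (hK : 2 ≤ K) (hL : 2 ≤ L) {m : Fin q}
    (hm : m ≠ one) (p : Site K L) {a b : ℕ} (ha : 1 ≤ a) (haK : a ≤ K) (hb : 1 ≤ b)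
    (hbL : b ≤ L) : excess h (mark m (rect p a b)) ≤ 2 * a + 2 * b - h * (a * b) := by
  induction a, ha using Nat.le_induction with
  | base =>
    induction b, hb using Nat.le_induction with
    | base =>
      have := (add_site (h := h) hK hL hm p).1
      push_cast
      linarith
    | succ b hb ih =>
      have h1 := ih (by omega)
      have h2 := (add_col h_pos hK hL hm p le_rfl haK hb (by omega)).1
      push_cast at *
      linarith
  | succ a ha ih =>
    have h1 := ih (by omega)
    have h2 := (add_row h_pos hK hL hm p ha (by omega) hb hbL).1
    push_cast
    linarith

end Potts

namespace Potts

open Landscape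

/-! ### Reference paths -/

variable {K L q : ℕ} [NeZero K] [NeZero L] [NeZero q]

theorem transpose_mem_of_excess_lt {h c : ℝ} :
    ∀ σ ∈ {z : Config K L q | excess h z < c}, transpose σ ∈ {z : Config L K q | excess h z < c} :=
  fun σ hσ => by
    change excess h _ < c
    rw [excess_transpose]
    exact hσ

/-- The growth of a droplet up to the size `l × (l - 1)`, row by row. The rows have the length
`l - 1`, so that each of them costs energy and the last one is the most expensive. -/
theorem joinedIn_const_rect {h : ℝ} {l : ℕ} (hl : IsCritical h l) (hK : l ≤ K) (hL : l ≤ L)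
    {m : Fin q} (hm : m ≠ one) (p : Site K L) :
    JoinedIn (flipGraph K L q) {z | excess h z < barrier h l} (const m)
      (mark m (rect p l (l - 1))) := by
  have h3 := hl.three_le
  have h3' : (3 : ℝ) ≤ l := by exact_mod_cast h3
  have hpos := hl.pos
  have hlt := hl.lt_one
  have hshr := hl.shrink
  have hbar := barrier_gt hl
  have hbar' : barrier h l = 4 * l - h * (l * (l - 1) + 1) := rfl
  have hK2 : 2 ≤ K := by omega
  have hL2 : 2 ≤ L := by omega
  have hsite := add_site (h := h) hK2 hL2 hm p
  have h0 : JoinedIn (flipGraph K L q) {z | excess h z < barrier h l} (const m)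
      (mark m (rect p 1 1)) := by
    refine .of_adj ?_ ?_ hsite.2
    · change excess h _ < _
      rw [excess_const h hm]; linarith
    · change excess h _ < _
      linarith [hsite.1]
  have h1 : ∀ b, 1 ≤ b → b ≤ l - 1 → JoinedIn (flipGraph K L q)
      {z | excess h z < barrier h l} (const m) (mark m (rect p 1 b)) := by
    intro b hb
    induction b, hb using Nat.le_induction with
    | base => exact fun _ => h0
    | succ b hb ih =>
      intro hbl
      have hE := excess_rect_le hpos hK2 hL2 hm p le_rfl (by omega) hb (by omega : b ≤ L)
      have hb1 : (1 : ℝ) ≤ b := by exact_mod_cast hb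
      have hb2 : (b : ℝ) + 2 ≤ l := by exact_mod_cast (by omega : b + 2 ≤ l)
      push_cast at hE
      refine (ih (by omega)).trans ((add_col hpos hK2 hL2 hm p le_rfl (by omega) hb
        (by omega)).2 _ ?_ ?_) <;> nlinarith
  have h2 : ∀ a, 1 ≤ a → a ≤ l → JoinedIn (flipGraph K L q)
      {z | excess h z < barrier h l} (const m) (mark m (rect p a (l - 1))) := by
    intro a ha
    induction a, ha using Nat.le_induction with
    | base => exact fun _ => h1 _ (by omega) le_rfl
    | succ a ha ih =>
      intro hal
      have hE := excess_rect_le hpos hK2 hL2 hm p ha (by omega : a ≤ K) (by omega : 1 ≤ l - 1)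
        (by omega)
      have ha1 : (a : ℝ) + 1 ≤ l := by exact_mod_cast hal
      rw [Nat.cast_sub (by omega), Nat.cast_one] at hE
      have hmul : (a : ℝ) * (2 - h * (l - 1)) ≤ (l - 1) * (2 - h * (l - 1)) :=
        mul_le_mul_of_nonneg_right (by linarith) (by linarith)
      have hpeak : excess h (mark m (rect p a (l - 1))) + 2 - h < barrier h l := by
        rw [hbar']
        nlinarith
      exact (ih (by omega)).trans ((add_row hpos hK2 hL2 hm p ha (by omega) (by omega)
        (by omega)).2 _ hpeak (by linarith))
  exact h2 l (by omega) le_rfl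

theorem excess_rect_le_of_ge {h : ℝ} {l : ℕ} (hl : IsCritical h l) {m : Fin q} (hm : m ≠ one)
    (p : Site K L) {a b : ℕ} (ha : l ≤ a) (haK : a ≤ K) (hb : l ≤ b) (hbL : b ≤ L) :
    excess h (mark m (rect p a b)) ≤ 4 * l - h * (l * l) := by
  have h3 := hl.three_le
  have hE := excess_rect_le hl.pos (by omega) (by omega) hm p (by omega) haK (by omega) hbL
  have ha' : (l : ℝ) ≤ a := by exact_mod_cast ha
  have hb' : (l : ℝ) ≤ b := by exact_mod_cast hb
  have hg := hl.grow
  have hpos := hl.pos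
  have h1 : 2 ≤ h * b := hg.le.trans (mul_le_mul_of_nonneg_left hb' hpos.le)
  have h2 : 0 ≤ (a - l : ℝ) * (h * b - 2) := mul_nonneg (by linarith) (by linarith)
  have h4 : 0 ≤ (b - l : ℝ) * (h * l - 2) := mul_nonneg (by linarith) (by linarith)
  linarith

/-- The growth of a droplet with sides at least `l`, until it covers the torus. -/
theorem joinedIn_rect_const_one {h : ℝ} {l : ℕ} (hl : IsCritical h l) (hK : l ≤ K) (hL : l ≤ L)
    {m : Fin q} (hm : m ≠ one) (p : Site K L) :
    JoinedIn (flipGraph K L q) {z | excess h z < barrier h l} (mark m (rect p l l))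
      (const one) := by
  have h3 := hl.three_le
  have hpos := hl.pos
  have hlt := hl.lt_one
  have hg := hl.grow
  have hbar : 4 * l - h * (l * l) + 2 - h < barrier h l := by
    rw [barrier]; linarith
  have h1 : ∀ b, l ≤ b → b ≤ L → JoinedIn (flipGraph K L q)
      {z | excess h z < barrier h l} (mark m (rect p l l)) (mark m (rect p l b)) := by
    intro b hb
    induction b, hb using Nat.le_induction with
    | base =>
      intro _
      refine .refl ?_
      have := excess_rect_le_of_ge hl hm p le_rfl hK le_rfl hL
      change excess h _ < _
      linarith
    | succ b hb ih =>
      intro hbL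
      have hE := excess_rect_le_of_ge hl hm p le_rfl hK hb (by omega)
      exact (ih (by omega)).trans ((add_col hpos (by omega) (by omega) hm p (by omega) hK
        (by omega) (by omega)).2 _ (by linarith) (by linarith))
  have h2 : ∀ a, l ≤ a → a ≤ K → JoinedIn (flipGraph K L q)
      {z | excess h z < barrier h l} (mark m (rect p l l)) (mark m (rect p a L)) := by
    intro a ha
    induction a, ha using Nat.le_induction with
    | base => exact fun _ => h1 L hL le_rfl
    | succ a ha ih =>
      intro haK
      have hE := excess_rect_le_of_ge hl hm p ha (by omega) hL le_rfl
      exact (ih (by omega)).trans ((add_row hpos (by omega) (by omega) hm p (by omega) (by omega)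
        (by omega) le_rfl).2 _ (by linarith) (by linarith))
  have := h2 K hK le_rfl
  rwa [mark_rect_univ] at this

/-! ### Paths through a critical droplet -/

/-- The sites of a row `[b, b + l)`, seen from its site `b + k`. -/
theorem mem_arc_iff_of_lt {n : ℕ} {b x : ZMod n} {k l : ℕ} (hk : k < l) :
    x ∈ arc b l ↔ x = b + k ∨ (∃ i < l - 1 - k, x = b + k + 1 + (i : ZMod n) * 1) ∨
      ∃ i < k, x = b + k - 1 + (i : ZMod n) * (-1) := by
  rw [mem_arc]
  constructor
  · rintro ⟨i, hi, rfl⟩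
    rcases lt_trichotomy i k with h | rfl | h
    · refine .inr (.inr ⟨k - 1 - i, by omega, ?_⟩)
      rw [Nat.cast_sub (by omega), Nat.cast_sub (by omega)]
      push_cast; ring
    · exact .inl rfl
    · refine .inr (.inl ⟨i - k - 1, by omega, ?_⟩)
      rw [Nat.cast_sub (by omega), Nat.cast_sub (by omega)]
      push_cast; ring
  · rintro (rfl | ⟨i, hi, rfl⟩ | ⟨i, hi, rfl⟩)
    · exact ⟨k, hk, rfl⟩
    · exact ⟨k + 1 + i, by omega, by push_cast; ring⟩
    · refine ⟨k - 1 - i, by omega, ?_⟩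
      rw [Nat.cast_sub (by omega), Nat.cast_sub (by omega)]
      push_cast; ring

theorem sub_one_notMem_arc {n : ℕ} {a : ZMod n} {t : ℕ} (ht : t < n) : a - 1 ∉ arc a t := by
  rw [mem_arc]
  rintro ⟨i, hi, h⟩
  have h1 : ((i + 1 : ℕ) : ZMod n) = 0 := by push_cast; linear_combination -h
  rw [ZMod.natCast_eq_zero_iff] at h1
  exact absurd (Nat.le_of_dvd (by omega) h1) (by omega)

/-- A critical droplet has energy at least the barrier: it deviates from the background on `l` rows
and `l` columns. -/
theorem barrier_le_excess {h : ℝ} {l : ℕ} (hl : IsCritical h l) (hK : l < K) (hL : l < L)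
    {m : Fin q} (hm : m ≠ one) (p v : Site K L) (hv1 : v.1 ∉ arc p.1 (l - 1))
    (hv2 : v.2 ∈ arc p.2 l) : barrier h l ≤ excess h (mark m (rect p (l - 1) l ∪ {v})) := by
  classical
  have h3 := hl.three_le
  set D := rect p (l - 1) l ∪ {v} with hD
  have hdev : ∀ u, mark m D u ≠ m ↔ u ∈ D := fun u => by
    by_cases hu : u ∈ D
    · simp [mark_of_mem hu, hu, hm.symm]
    · simp [mark_of_notMem hu, hu]
  have hmem : ∀ u, u ∈ D ↔ (u.1 ∈ arc p.1 (l - 1) ∧ u.2 ∈ arc p.2 l) ∨ u = v := fun u => by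
    rw [hD, Set.mem_union, mem_rect, Set.mem_singleton_iff]
  have hr : devRows m (mark m D) = insert v.1 (arc p.1 (l - 1)) := by
    ext i
    simp only [mem_devRows, hdev, hmem, Finset.mem_insert]
    constructor
    · rintro ⟨j, hj | hj⟩
      exacts [.inr hj.1, .inl (congrArg Prod.fst hj)]
    · rintro (rfl | hi)
      exacts [⟨v.2, .inr rfl⟩, ⟨v.2, .inl ⟨hi, hv2⟩⟩]
  have hc : devCols m (mark m D) = arc p.2 l := by
    ext j
    simp only [mem_devCols, hdev, hmem]
    constructor
    · rintro ⟨i, hi | hi⟩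
      exacts [hi.2, by rwa [show j = v.2 from congrArg Prod.snd hi]]
    · intro hj
      exact ⟨p.1, .inl ⟨mem_arc.2 ⟨0, by omega, by simp⟩, hj⟩⟩
  have hrc : (devRows m (mark m D)).card = l := by
    rw [hr, Finset.card_insert_of_notMem hv1, card_arc (by omega)]
    omega
  have hcc : (devCols m (mark m D)).card = l := by
    rw [hc, card_arc hL.le]
  have hbg : HasBackground m (mark m D) := by
    constructor
    · intro hu
      rw [hu, Finset.card_univ, ZMod.card] at hrc
      omega
    · intro hu
      rw [hu, Finset.card_univ, ZMod.card] at hcc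
      omega
  have hones : ones (mark m D) ≤ l * (l - 1) + 1 := by
    have hsub : (Finset.univ.filter fun u => mark m D u = one) ⊆
        insert v (arc p.1 (l - 1) ×ˢ arc p.2 l) := by
      intro u hu
      have hu' : mark m D u = one := (Finset.mem_filter.1 hu).2
      have huD : u ∈ D := (hdev u).1 (by rw [hu']; exact hm.symm)
      rw [Finset.mem_insert, Finset.mem_product]
      exact ((hmem u).1 huD).symm
    refine (Finset.card_le_card hsub).trans ((Finset.card_insert_le _ _).trans ?_)
    rw [Finset.card_product, card_arc (by omega), card_arc hL.le, mul_comm]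
  have hge := hbg.excess_ge (h := h)
  rw [hrc, hcc] at hge
  have hones' : (ones (mark m D) : ℝ) ≤ l * (l - 1) + 1 := by
    rw [← cast_mul_pred h3]; exact_mod_cast hones
  have hpos := hl.pos
  rw [barrier]
  nlinarith

/-- The configurations below the level `c`, and `w`. -/
def belowOr (h c : ℝ) (w : Config K L q) : Set (Config K L q) := {z | z = w ∨ excess h z < c}

/-- A critical droplet whose additional site lies in a row next to a rectangle `(l - 1) × l` has
energy equal to the barrier, and it is the only state at this level on some path. -/
theorem droplet_row {h : ℝ} {l : ℕ} (hl : IsCritical h l) (hK : l < K) (hL : l < L)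
    {m : Fin q} (hm : m ≠ one) (p : Site K L) {x : ZMod K} {k : ℕ} (hk : k < l)
    (hx : x = p.1 - 1 ∨ x = p.1 + ((l - 1 : ℕ) : ZMod K)) {w : Config K L q}
    (hw : w = mark m (rect p (l - 1) l ∪ {(x, p.2 + (k : ZMod L))})) :
    excess h w = barrier h l ∧
    JoinedIn (flipGraph K L q) (belowOr h (barrier h l) w) (const m) w ∧
    JoinedIn (flipGraph K L q) (belowOr h (barrier h l) w) w (const one) := by
  have h3 := hl.three_le
  have hpos := hl.pos
  have hlt := hl.lt_one
  have hg := hl.grow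
  have hK2 : 2 ≤ K := by omega
  have hL2 : 2 ≤ L := by omega
  have hxn : x ∉ arc p.1 (l - 1) := by
    rcases hx with rfl | rfl
    · exact sub_one_notMem_arc (by omega)
    · exact add_notMem_arc le_rfl (by omega)
  have hupd : w = Function.update (mark m (rect p (l - 1) l)) (x, p.2 + (k : ZMod L)) one := by
    rw [hw, mark_insert]
  -- each site of the row `x` next to the rectangle has a neighbour in the rectangle
  have hrowm : ∀ y, mark m (rect p (l - 1) l) (x, y) = m := fun y =>
    mark_of_notMem fun hcon => hxn (mem_rect.1 hcon).1
  have hrowv : ∀ y ∈ arc p.2 l, mark m (rect p (l - 1) l) ((x, y) - (1, 0)) = one ∨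
      mark m (rect p (l - 1) l) ((x, y) + (1, 0)) = one := by
    intro y hy
    rcases hx with rfl | rfl
    · right
      refine mark_of_mem (mem_rect.2 ⟨mem_arc.2 ⟨0, by omega, ?_⟩, by simpa using hy⟩)
      simp
    · left
      refine mark_of_mem (mem_rect.2 ⟨mem_arc.2 ⟨l - 2, by omega, ?_⟩, by simpa using hy⟩)
      rw [Nat.cast_sub (by omega), Nat.cast_sub (by omega)]
      simp only [Prod.mk_sub_mk]
      push_cast
      ring
  have hkmem : p.2 + (k : ZMod L) ∈ arc p.2 l := mem_arc.2 ⟨k, hk, rfl⟩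
  have hE0 := excess_rect_le hpos hK2 hL2 hm p (by omega : 1 ≤ l - 1) (by omega) (by omega : 1 ≤ l)
    hL.le
  rw [Nat.cast_sub (by omega), Nat.cast_one] at hE0
  have hEw : excess h w = barrier h l := by
    refine le_antisymm ?_ (hw ▸ barrier_le_excess hl hK hL hm p _ hxn hkmem)
    rw [hupd]
    refine (excess_update_le_add_two hK2 hL2 h hm (hrowm _) (hrowv _ hkmem)).trans ?_
    rw [barrier]
    linarith
  refine ⟨hEw, ?_, ?_⟩
  · have h1 := joinedIn_transpose transpose_mem_of_excess_lt
      (joinedIn_const_rect hl hL.le hK.le hm p.swap)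
    rw [transpose_mark_rect, Prod.swap_swap] at h1
    refine (h1.mono fun z hz => Or.inr hz).trans (.of_adj (.inr ?_) (.inl rfl) ?_)
    · change excess h _ < _
      rw [barrier]
      linarith
    · rw [hupd]
      exact flipGraph_adj_update (by rw [hrowm]; exact hm)
  -- the bar grows to the right and then to the left
  have hwrow : ∀ y, y ≠ p.2 + (k : ZMod L) → w (x, y) = m := fun y hy => by
    rw [hupd, Function.update_of_ne (by simpa using hy), hrowm]
  have hwone : ∀ u, mark m (rect p (l - 1) l) u = one → w u = one := fun u hu => by
    rw [hupd]
    by_cases huv : u = (x, p.2 + (k : ZMod L))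
    · rw [huv, Function.update_self]
    · rw [Function.update_of_ne huv, hu]
  have hwvert : ∀ y ∈ arc p.2 l, w ((x, y) - (1, 0)) = one ∨ w ((x, y) + (1, 0)) = one :=
    fun y hy => (hrowv y hy).imp (hwone _) (hwone _)
  have hwk : w (x, p.2 + (k : ZMod L)) = one := by rw [hupd, Function.update_self]
  have hright : ∀ i < l - 1 - k, ∃ t < l, k < t ∧
      (x, p.2 + (k : ZMod L) + 1) + (0, (i : ZMod L) * 1) = ((x, p.2 + (t : ZMod L)) : Site K L) :=
    fun i hi => ⟨k + 1 + i, by omega, by omega, Prod.ext (by simp) (by simp; ring)⟩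
  have hleft : ∀ i < k, ∃ t < k,
      (x, p.2 + (k : ZMod L) - 1) + (0, (i : ZMod L) * (-1)) =
        ((x, p.2 + (t : ZMod L)) : Site K L) :=
    fun i hi => ⟨k - 1 - i, by omega, Prod.ext (by simp) (by
      rw [Nat.cast_sub (by omega), Nat.cast_sub (by omega)]
      simp only [Prod.mk_add_mk]
      push_cast
      ring)⟩
  have hne : ∀ t < l, t ≠ k → p.2 + (t : ZMod L) ≠ p.2 + (k : ZMod L) := fun t ht htk hcon =>
    htk (natCast_inj_of_lt (by omega) (by omega) (add_left_cancel hcon))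
  set σ := fillRow w (x, p.2 + (k : ZMod L) + 1) 1 (l - 1 - k) with hσ
  have h1m : ∀ i < l - 1 - k, w ((x, p.2 + (k : ZMod L) + 1) + (0, (i : ZMod L) * 1)) = m := by
    intro i hi
    obtain ⟨t, ht, hkt, heq⟩ := hright i hi
    rw [heq]
    exact hwrow _ (hne t ht (by omega))
  have h1v : ∀ i < l - 1 - k,
      w ((x, p.2 + (k : ZMod L) + 1) + (0, (i : ZMod L) * 1) - (1, 0)) = one ∨
      w ((x, p.2 + (k : ZMod L) + 1) + (0, (i : ZMod L) * 1) + (1, 0)) = one := by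
    intro i hi
    obtain ⟨t, ht, hkt, heq⟩ := hright i hi
    rw [heq]
    exact hwvert _ (mem_arc.2 ⟨t, ht, rfl⟩)
  have h1E : ∀ i, 0 < i → i ≤ l - 1 - k →
      excess h (fillRow w (x, p.2 + (k : ZMod L) + 1) 1 i) ≤ excess h w + 0 - h * i := by
    intro i hi hil
    refine excess_fillRow_le hK2 hL2 hm (.inl rfl) (by omega) h1m h1v ?_ i hi hil
    rw [fillRow_succ, fillRow_zero, add_zero]
    refine excess_update_le_sub hK2 hL2 h hm (h1m 0 (by omega)) (h1v 0 (by omega)) (.inl ?_)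
    convert hwk using 2
    ext <;> simp
  have h1 : JoinedIn (flipGraph K L q) (belowOr h (barrier h l) w) w σ := by
    refine joinedIn_fillRow hm (.inl rfl) (by omega) h1m fun i hi => ?_
    rcases Nat.eq_zero_or_pos i with rfl | hi'
    · exact .inl (fillRow_zero ..)
    · have h5 := h1E i hi' hi
      have h6 : 0 < h * i := mul_pos hpos (by exact_mod_cast hi')
      exact .inr (by linarith)
  have hσle : excess h σ ≤ barrier h l := by
    rcases Nat.eq_zero_or_pos (l - 1 - k) with h0 | h0
    · rw [hσ, h0, fillRow_zero, hEw]
    · have h5 := h1E _ h0 le_rfl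
      have h6 : 0 ≤ h * ((l - 1 - k : ℕ) : ℝ) := by positivity
      linarith
  have hσmem : σ ∈ belowOr h (barrier h l) w := by
    obtain ⟨r, hr⟩ := h1
    exact hr _ r.end_mem_support
  have hσone : ∀ u, w u = one → σ u = one := fun u hu => fillRow_of_eq_one hu ..
  have h2m : ∀ i < k, σ ((x, p.2 + (k : ZMod L) - 1) + (0, (i : ZMod L) * (-1))) = m := by
    intro i hi
    obtain ⟨t, ht, heq⟩ := hleft i hi
    rw [heq, hσ, fillRow, if_neg, hwrow _ (hne t (by omega) (by omega))]
    rintro ⟨i', hi', hcon⟩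
    obtain ⟨t', ht', hkt', heq'⟩ := hright i' hi'
    rw [heq'] at hcon
    have := natCast_inj_of_lt (by omega) (by omega) (add_left_cancel (congrArg Prod.snd hcon))
    omega
  have h2v : ∀ i < k,
      σ ((x, p.2 + (k : ZMod L) - 1) + (0, (i : ZMod L) * (-1)) - (1, 0)) = one ∨
      σ ((x, p.2 + (k : ZMod L) - 1) + (0, (i : ZMod L) * (-1)) + (1, 0)) = one := by
    intro i hi
    obtain ⟨t, ht, heq⟩ := hleft i hi
    rw [heq]
    exact (hwvert _ (mem_arc.2 ⟨t, by omega, rfl⟩)).imp (hσone _) (hσone _)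
  have h2E : ∀ i, 0 < i → i ≤ k →
      excess h (fillRow σ (x, p.2 + (k : ZMod L) - 1) (-1) i) ≤ excess h σ + 0 - h * i := by
    intro i hi hil
    refine excess_fillRow_le hK2 hL2 hm (.inr rfl) (by omega) h2m h2v ?_ i hi hil
    rw [fillRow_succ, fillRow_zero, add_zero]
    refine excess_update_le_sub hK2 hL2 h hm (h2m 0 (by omega)) (h2v 0 (by omega)) (.inr ?_)
    convert hσone _ hwk using 2
    ext <;> simp
  have h2 : JoinedIn (flipGraph K L q) (belowOr h (barrier h l) w) σ
      (fillRow σ (x, p.2 + (k : ZMod L) - 1) (-1) k) := by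
    refine joinedIn_fillRow hm (.inr rfl) (by omega) h2m fun i hi => ?_
    rcases Nat.eq_zero_or_pos i with rfl | hi'
    · rwa [fillRow_zero]
    · have h5 := h2E i hi' hi
      have h6 : 0 < h * i := mul_pos hpos (by exact_mod_cast hi')
      exact .inr (by linarith)
  -- the full bar completes the rectangle to a square
  obtain ⟨p', hp'⟩ : ∃ p' : Site K L, ∀ u : Site K L, u ∈ rect p' l l ↔
      u ∈ rect p (l - 1) l ∨ (u.1 = x ∧ u.2 ∈ arc p.2 l) := by
    have hl1 : l = l - 1 + 1 := by omega
    rcases hx with rfl | rfl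
    · refine ⟨(p.1 - 1, p.2), fun u => ?_⟩
      rw [mem_rect, mem_rect, ← or_and_right]
      refine and_congr_left fun _ => ?_
      rw [mem_arc, mem_arc]
      constructor
      · rintro ⟨i, hi, h⟩
        rcases Nat.eq_zero_or_pos i with rfl | hi'
        · exact .inr (by simpa using h)
        · refine .inl ⟨i - 1, by omega, ?_⟩
          rw [h, Nat.cast_sub hi']
          push_cast
          ring
      · rintro (⟨i, hi, h⟩ | h)
        · exact ⟨i + 1, by omega, by rw [h]; push_cast; ring⟩
        · exact ⟨0, by omega, by simpa using h⟩
    · refine ⟨p, fun u => ?_⟩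
      rw [mem_rect, mem_rect, ← or_and_right]
      refine and_congr_left fun _ => ?_
      conv_lhs => rw [hl1, mem_arc_succ]
  have hfinal : fillRow σ (x, p.2 + (k : ZMod L) - 1) (-1) k = mark m (rect p' l l) := by
    ext1 u
    have hu : u ∈ rect p' l l ↔
        (∃ i < k, u = (x, p.2 + (k : ZMod L) - 1) + (0, (i : ZMod L) * -1)) ∨
        (∃ i < l - 1 - k, u = (x, p.2 + (k : ZMod L) + 1) + (0, (i : ZMod L) * 1)) ∨
        u ∈ rect p (l - 1) l ∪ {(x, p.2 + (k : ZMod L))} := by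
      rw [hp', mem_arc_iff_of_lt hk, Set.mem_union, Set.mem_singleton_iff]
      simp only [Prod.ext_iff, Prod.fst_add, Prod.snd_add, add_zero]
      constructor
      · rintro (h | ⟨h, h' | ⟨i, hi, h'⟩ | ⟨i, hi, h'⟩⟩)
        exacts [.inr (.inr (.inl h)), .inr (.inr (.inr ⟨h, h'⟩)), .inr (.inl ⟨i, hi, h, h'⟩),
          .inl ⟨i, hi, h, h'⟩]
      · rintro (⟨i, hi, h, h'⟩ | ⟨i, hi, h, h'⟩ | h | ⟨h, h'⟩)
        exacts [.inr ⟨h, .inr (.inr ⟨i, hi, h'⟩)⟩, .inr ⟨h, .inr (.inl ⟨i, hi, h'⟩)⟩, .inl h,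
          .inr ⟨h, .inl h'⟩]
    unfold fillRow
    split_ifs with hA
    · rw [mark_of_mem (hu.2 (.inl hA))]
    · rw [hσ]
      unfold fillRow
      split_ifs with hB
      · rw [mark_of_mem (hu.2 (.inr (.inl hB)))]
      · rw [hw]
        by_cases hC : u ∈ rect p (l - 1) l ∪ {(x, p.2 + (k : ZMod L))}
        · rw [mark_of_mem hC, mark_of_mem (hu.2 (.inr (.inr hC)))]
        · rw [mark_of_notMem hC, mark_of_notMem fun hcon =>
            (hu.1 hcon).elim hA fun h => h.elim hB hC]
  rw [hfinal] at h2
  exact (h1.trans h2).trans ((joinedIn_rect_const_one hl hK.le hL.le hm p').mono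
    fun z hz => Or.inr hz)

theorem droplet_transpose {h c : ℝ} {m : Fin q} {w : Config K L q}
    (hw : excess h w = c ∧
      JoinedIn (flipGraph K L q) (belowOr h c w) (const m) w ∧
      JoinedIn (flipGraph K L q) (belowOr h c w) w (const one)) :
    excess h (transpose w) = c ∧
      JoinedIn (flipGraph L K q) (belowOr h c (transpose w)) (const m) (transpose w) ∧
      JoinedIn (flipGraph L K q) (belowOr h c (transpose w)) (transpose w) (const one) := by
  have hPQ : ∀ σ ∈ belowOr h c w, transpose σ ∈ belowOr h c (transpose w) := by
    rintro σ (rfl | hσ)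
    · exact .inl rfl
    · exact .inr (by rwa [excess_transpose])
  exact ⟨by rw [excess_transpose]; exact hw.1, joinedIn_transpose hPQ hw.2.1,
    joinedIn_transpose hPQ hw.2.2⟩

/-- Each critical droplet has energy equal to the barrier, and it is the only state at this level
on some path between the constant configurations. -/
theorem droplet {h : ℝ} {l : ℕ} (hl : IsCritical h l) (hK : l < K) (hL : l < L)
    {m : Fin q} (hm : m ≠ one) {w : Config K L q} (hw : w ∈ barB (l - 1) l 1 m one) :
    excess h w = barrier h l ∧
    JoinedIn (flipGraph K L q) (belowOr h (barrier h l) w) (const m) w ∧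
    JoinedIn (flipGraph K L q) (belowOr h (barrier h l) w) w (const one) := by
  obtain ⟨D, ⟨p, k, hk, hD⟩, h1, h2⟩ := hw
  have hw := eq_mark h1 h2
  simp only [rect_one_one] at hD
  rcases hD with rfl | rfl | rfl | rfl
  · refine droplet_row hl hK hL hm p hk (.inl rfl) (hw.trans ?_)
    congr 3
    exact Prod.ext (by simp [sub_eq_add_neg]) (by simp)
  · refine droplet_row hl hK hL hm p hk (.inr rfl) (hw.trans ?_)
    congr 3
  · refine droplet_transpose (w := transpose w) (droplet_row hl hL hK hm p.swap hk (.inl rfl) ?_)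
    rw [hw, transpose_mark_rect_insert]
    congr 3
    exact Prod.ext (by simp [sub_eq_add_neg]) (by simp)
  · refine droplet_transpose (w := transpose w) (droplet_row hl hL hK hm p.swap hk (.inr rfl) ?_)
    rw [hw, transpose_mark_rect_insert]
    congr 3

end Potts

namespace Potts

open Landscape

/-! ### Copying rows -/

section Rows

theorem bdry_arc_le_two {n : ℕ} [NeZero n] (a : ZMod n) (k : ℕ) :
    bdry (fun j => j ∈ arc a k) ≤ 2 := by
  refine (Finset.card_le_card (t := {a - 1, a + k - 1}) fun j hj => ?_).trans Finset.card_le_two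
  simp only [Finset.mem_filter] at hj
  rw [Finset.mem_insert, Finset.mem_singleton]
  by_cases h1 : j ∈ arc a k
  · have h2 : j + 1 ∉ arc a k := fun h2 => hj.2 (by simp [h1, h2])
    right
    have := eq_add_of_notMem_arc h2 (by simpa using h1)
    linear_combination this
  · have h2 : j + 1 ∈ arc a k := by
      by_contra h2
      exact hj.2 (by simp [h1, h2])
    exact .inl (eq_sub_of_notMem_arc h1 h2)

theorem arc_eq_univ {n : ℕ} [NeZero n] (a : ZMod n) : arc a n = Finset.univ :=
  Finset.eq_univ_iff_forall.2 fun x => mem_arc.2 (exists_eq_add_natCast a x)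

theorem sum_arc {n : ℕ} {a : ZMod n} {k : ℕ} (hk : k ≤ n) (e : ZMod n → ℝ) :
    ∑ j ∈ arc a k, e j = ∑ i ∈ Finset.range k, e (a + (i : ZMod n)) := by
  rw [arc, Finset.sum_image]
  intro i hi j hj hij
  simp only [Finset.coe_range, Set.mem_Iio] at hi hj
  exact natCast_inj_of_lt (by omega) (by omega) (add_left_cancel hij)

/-- The cycle lemma: if the sum around a cycle is not positive, then some starting point makes all
the partial sums nonpositive. -/
theorem exists_partial_sums_nonpos {n : ℕ} [NeZero n] (e : ZMod n → ℝ) (he : ∑ j, e j ≤ 0) :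
    ∃ a, ∀ k ≤ n, ∑ j ∈ arc a k, e j ≤ 0 := by
  set P : ℕ → ℝ := fun k => ∑ i ∈ Finset.range k, e (i : ZMod n) with hP
  have hadd : ∀ b k, P (b + k) = P b + ∑ i ∈ Finset.range k, e ((b : ZMod n) + (i : ZMod n)) := by
    intro b k
    simp only [hP]
    rw [Finset.sum_range_add]
    push_cast
    rfl
  have htot : P n ≤ 0 := by
    have h1 := sum_arc (a := 0) le_rfl e
    rw [arc_eq_univ] at h1
    simp only [zero_add] at h1
    change ∑ i ∈ Finset.range n, e (i : ZMod n) ≤ 0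
    rwa [← h1]
  obtain ⟨b, hb, hmax⟩ := Finset.exists_max_image (Finset.range n) P
    ⟨0, Finset.mem_range.2 (Nat.pos_of_ne_zero (NeZero.ne n))⟩
  rw [Finset.mem_range] at hb
  refine ⟨b, fun k hk => ?_⟩
  rw [sum_arc hk]
  have h1 := hadd b k
  suffices h : P (b + k) ≤ P b by linarith
  rcases Nat.lt_or_ge (b + k) n with h2 | h2
  · exact hmax _ (Finset.mem_range.2 h2)
  · have h3 := hadd n (b + k - n)
    rw [Nat.add_sub_cancel' h2] at h3
    simp only [CharP.cast_eq_zero, zero_add] at h3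
    have h4 := hmax (b + k - n) (Finset.mem_range.2 (by omega))
    linarith

variable {K L q : ℕ} [NeZero K] [NeZero L] [NeZero q]

/-- The energy of a row: its disagreeing edges and the contribution of the field. -/
def rowCost (h : ℝ) (x : ZMod L → Fin q) : ℝ :=
  ∑ j, (dis (x j) (x (j + 1)) - h * if x j = one then 1 else 0)

theorem excess_rows (h : ℝ) (R : ZMod K → ZMod L → Fin q) :
    excess h (Function.uncurry R) =
      ∑ i, rowCost h (R i) + ∑ i, ∑ j, dis (R i j) (R (i + 1) j) := by
  rw [excess, breaks, cast_ones, Fintype.sum_prod_type]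
  push_cast
  simp only [cast_bdry, Function.uncurry, rowCost, Finset.sum_sub_distrib, ← Finset.mul_sum]
  rw [Finset.sum_comm (s := Finset.univ (α := ZMod L))]
  exact add_sub_right_comm _ _ _

/-- If a row is replaced by a mixture of itself and of the preceding row, then only its own cost
may increase: the number of the disagreeing vertical edges does not, by the triangle inequality. -/
theorem excess_update_row_le (hK : 2 ≤ K) (h : ℝ) (R : ZMod K → ZMod L → Fin q) (i : ZMod K)
    {z : ZMod L → Fin q} (hz : ∀ j, z j = R i j ∨ z j = R (i + 1) j) :
    excess h (Function.uncurry (Function.update R (i + 1) z)) ≤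
      excess h (Function.uncurry R) + rowCost h z - rowCost h (R (i + 1)) := by
  have h1 : (1 : ZMod K) ≠ 0 := by
    intro h
    have : ((1 : ℕ) : ZMod K) = (0 : ℕ) := by simpa using h
    exact absurd (natCast_inj_of_lt (by omega) (by omega) this) one_ne_zero
  have hi1 : i ≠ i + 1 := fun h => h1 (by linear_combination -h)
  have hi2 : i + 1 + 1 ≠ i + 1 := fun h => h1 (by linear_combination h)
  have hcost : ∑ i', rowCost h (Function.update R (i + 1) z i') =
      ∑ i', rowCost h (R i') + (rowCost h z - rowCost h (R (i + 1))) := by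
    rw [← sub_eq_iff_eq_add', ← Finset.sum_sub_distrib, Finset.sum_eq_single (i + 1)]
    · rw [Function.update_self]
    · intro i' _ hi'
      rw [Function.update_of_ne hi', sub_self]
    · simp
  have hvert : ∑ i', ∑ j, dis (Function.update R (i + 1) z i' j)
      (Function.update R (i + 1) z (i' + 1) j) ≤ ∑ i', ∑ j, dis (R i' j) (R (i' + 1) j) := by
    rw [← sub_nonpos, ← Finset.sum_sub_distrib, Finset.sum_eq_add i (i + 1) hi1]
    · rw [Function.update_self, Function.update_of_ne hi1, Function.update_of_ne hi2,
        ← Finset.sum_sub_distrib, ← Finset.sum_sub_distrib, ← Finset.sum_add_distrib]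
      refine Finset.sum_nonpos fun j _ => ?_
      rcases hz j with hj | hj <;> rw [hj]
      · have h2 := dis_triangle (R i j) (R (i + 1) j) (R (i + 1 + 1) j)
        rw [dis_self]
        linarith
      · linarith
    · intro i' _ hi'
      rw [Function.update_of_ne hi'.2,
        Function.update_of_ne fun h => hi'.1 (add_right_cancel h), sub_self]
    · simp
    · simp
  rw [excess_rows, excess_rows, hcost]
  linarith

open Classical in
/-- The row with the values of `y` on an arc and those of `x` elsewhere. -/
def mixRow (x y : ZMod L → Fin q) (a : ZMod L) (k : ℕ) : ZMod L → Fin q :=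
  fun j => if j ∈ arc a k then y j else x j

/-- The two ends of the arc add at most two disagreeing edges. -/
theorem rowCost_mixRow_le (h : ℝ) (x y : ZMod L → Fin q) (a : ZMod L) (k : ℕ) :
    rowCost h (mixRow x y a k) ≤ rowCost h x + ∑ j ∈ arc a k,
      ((dis (y j) (y (j + 1)) - h * if y j = one then 1 else 0)
        - (dis (x j) (x (j + 1)) - h * if x j = one then 1 else 0)) + 2 := by
  classical
  have hb : ∑ j, dis (j ∈ arc a k) (j + 1 ∈ arc a k) ≤ 2 := by
    rw [← cast_bdry]
    exact_mod_cast bdry_arc_le_two a k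
  have hsum : ∀ e : ZMod L → ℝ, ∑ j ∈ arc a k, e j = ∑ j, if j ∈ arc a k then e j else 0 :=
    fun e => by rw [Finset.sum_ite_mem, Finset.univ_inter]
  refine le_trans ?_ (add_le_add_right hb _)
  rw [hsum, rowCost, rowCost, ← Finset.sum_add_distrib, ← Finset.sum_add_distrib]
  refine Finset.sum_le_sum fun j _ => ?_
  by_cases h1 : j ∈ arc a k <;> by_cases h2 : j + 1 ∈ arc a k <;>
    simp only [mixRow, h1, h2, if_true, if_false]
  · linarith [dis_nonneg True True]
  · rw [dis_of_ne (by simp : True ≠ False)]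
    linarith [dis_le_one (y j) (x (j + 1)), dis_nonneg (y j) (y (j + 1))]
  · rw [dis_of_ne (by simp : False ≠ True)]
    linarith [dis_le_one (x j) (y (j + 1)), dis_nonneg (x j) (x (j + 1))]
  · linarith [dis_nonneg False False]

/-- A row can be copied onto the next one at the price of a barrier of at most `2`, unless the copy
has a larger cost. -/
theorem copy_row (hK : 2 ≤ K) (h : ℝ) (R : ZMod K → ZMod L → Fin q) (i : ZMod K)
    (hi : rowCost h (R i) ≤ rowCost h (R (i + 1))) :
    excess h (Function.uncurry (Function.update R (i + 1) (R i))) ≤ excess h (Function.uncurry R) ∧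
    JoinedIn (flipGraph K L q) {τ | excess h τ ≤ excess h (Function.uncurry R) + 2}
      (Function.uncurry R) (Function.uncurry (Function.update R (i + 1) (R i))) := by
  constructor
  · linarith [excess_update_row_le hK h R i (z := R i) fun j => .inl rfl]
  obtain ⟨a, ha⟩ := exists_partial_sums_nonpos (fun j =>
    (dis (R i j) (R i (j + 1)) - h * if R i j = one then 1 else 0)
      - (dis (R (i + 1) j) (R (i + 1) (j + 1)) - h * if R (i + 1) j = one then 1 else 0)) (by
    rw [Finset.sum_sub_distrib]
    exact sub_nonpos.2 hi)
  have h0 : mixRow (R (i + 1)) (R i) a 0 = R (i + 1) := by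
    ext1 j
    simp [mixRow, mem_arc]
  have hL : mixRow (R (i + 1)) (R i) a L = R i := by
    ext1 j
    simp [mixRow, arc_eq_univ]
  have := JoinedIn.of_seq (G := flipGraph K L q)
    (P := {τ | excess h τ ≤ excess h (Function.uncurry R) + 2})
    (fun k => Function.uncurry (Function.update R (i + 1) (mixRow (R (i + 1)) (R i) a k))) L
    (fun k hk => ?_) (fun k hk => ?_)
  · rwa [h0, hL, Function.update_eq_self] at this
  · have h1 := excess_update_row_le hK h R i (z := mixRow (R (i + 1)) (R i) a k) fun j => by
      unfold mixRow; split_ifs <;> simp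
    have h2 := rowCost_mixRow_le h (R (i + 1)) (R i) a k
    have h3 := ha k hk
    change excess h _ ≤ _
    linarith
  · rw [or_iff_not_imp_left]
    intro hne
    have hv : ∀ u : Site K L, u ≠ (i + 1, a + (k : ZMod L)) →
        Function.uncurry (Function.update R (i + 1) (mixRow (R (i + 1)) (R i) a k)) u =
        Function.uncurry (Function.update R (i + 1) (mixRow (R (i + 1)) (R i) a (k + 1))) u := by
      rintro ⟨i', j⟩ hu
      simp only [Function.uncurry]
      by_cases hi' : i' = i + 1
      · subst hi'
        have hj : j ≠ a + (k : ZMod L) := fun hj => hu (by rw [hj])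
        have : j ∈ arc a (k + 1) ↔ j ∈ arc a k := by
          rw [mem_arc_succ, or_iff_left hj]
        simp only [Function.update_self, mixRow, this]
      · rw [Function.update_of_ne hi', Function.update_of_ne hi']
    refine flipGraph_adj.2 ⟨_, fun heq => hne (funext fun u => ?_), hv⟩
    by_cases hu : u = (i + 1, a + (k : ZMod L))
    · rw [hu]; exact heq
    · exact hv u hu

open Classical in
/-- The rows obtained from `R` by copying the row `i` onto the `t` rows that follow it. -/
def copyRows (R : ZMod K → ZMod L → Fin q) (i : ZMod K) (t : ℕ) : ZMod K → ZMod L → Fin q :=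
  fun i' => if i' ∈ arc i (t + 1) then R i else R i'

theorem copy_rows (hK : 2 ≤ K) (h : ℝ) (R : ZMod K → ZMod L → Fin q) (i : ZMod K)
    (hi : ∀ i', rowCost h (R i) ≤ rowCost h (R i')) (t : ℕ) (ht : t < K) :
    excess h (Function.uncurry (copyRows R i t)) ≤ excess h (Function.uncurry R) ∧
    JoinedIn (flipGraph K L q) {τ | excess h τ ≤ excess h (Function.uncurry R) + 2}
      (Function.uncurry R) (Function.uncurry (copyRows R i t)) := by
  induction t with
  | zero =>
    have h0 : copyRows R i 0 = R := by
      ext1 i'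
      by_cases h : i' = i <;> simp [copyRows, mem_arc, h]
    rw [h0]
    refine ⟨le_rfl, .refl ?_⟩
    change excess h _ ≤ excess h _ + 2
    linarith
  | succ t ih =>
    obtain ⟨h1, h2⟩ := ih (by omega)
    have hcast : i + ((t + 1 : ℕ) : ZMod K) = i + (t : ZMod K) + 1 := by push_cast; ring
    have hs : copyRows R i t (i + (t : ZMod K)) = R i :=
      if_pos (mem_arc.2 ⟨t, by omega, rfl⟩)
    have hs' : copyRows R i t (i + (t : ZMod K) + 1) = R (i + (t : ZMod K) + 1) := by
      rw [← hcast]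
      exact if_neg (add_notMem_arc le_rfl ht)
    have hstep : copyRows R i (t + 1) =
        Function.update (copyRows R i t) (i + (t : ZMod K) + 1)
          (copyRows R i t (i + (t : ZMod K))) := by
      ext1 i'
      by_cases hi' : i' = i + (t : ZMod K) + 1
      · rw [hi', Function.update_self, hs]
        exact if_pos (mem_arc.2 ⟨t + 1, by omega, hcast.symm⟩)
      · have : i' ∈ arc i (t + 1 + 1) ↔ i' ∈ arc i (t + 1) := by
          rw [mem_arc_succ (t := t + 1), or_iff_left (by rwa [hcast])]
        rw [Function.update_of_ne hi']
        simp only [copyRows, this]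
    obtain ⟨h3, h4⟩ := copy_row hK h (copyRows R i t) (i + (t : ZMod K)) (by
      rw [hs, hs']; exact hi _)
    rw [hstep]
    refine ⟨h3.trans h1, h2.trans (h4.mono fun τ hτ => ?_)⟩
    change excess h τ ≤ _ at hτ
    change excess h τ ≤ _
    linarith

/-- If the rows are not all equal, then copying the cheapest row onto all the others decreases the
energy. -/
theorem exists_lower_of_rows (hK : 2 ≤ K) (h : ℝ) {σ : Config K L q}
    (hσ : ∃ i i' j, σ (i, j) ≠ σ (i', j)) :
    ∃ τ, excess h τ < excess h σ ∧
      JoinedIn (flipGraph K L q) {ρ | excess h ρ ≤ excess h σ + 2} σ τ := by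
  obtain ⟨R, rfl⟩ : ∃ R : ZMod K → ZMod L → Fin q, σ = Function.uncurry R :=
    ⟨Function.curry σ, (Function.uncurry_curry σ).symm⟩
  obtain ⟨i₀, -, hi₀⟩ := Finset.exists_min_image Finset.univ (fun i => rowCost h (R i))
    ⟨0, Finset.mem_univ _⟩
  obtain ⟨-, hjoin⟩ := copy_rows hK h R i₀ (fun i' => hi₀ i' (Finset.mem_univ _)) (K - 1)
    (by omega)
  refine ⟨_, ?_, hjoin⟩
  have hall : copyRows R i₀ (K - 1) = fun _ => R i₀ := by
    ext1 i'
    refine if_pos ?_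
    rw [Nat.sub_add_cancel (by omega), arc_eq_univ]
    exact Finset.mem_univ _
  have hvert : 0 < ∑ i, ∑ j, dis (R i j) (R (i + 1) j) := by
    have hnn : ∀ i ∈ Finset.univ, 0 ≤ ∑ j, dis (R i j) (R (i + 1) j) :=
      fun i _ => Finset.sum_nonneg fun j _ => dis_nonneg _ _
    refine lt_of_le_of_ne (Finset.sum_nonneg hnn) fun h0 => ?_
    have heq : ∀ i j, R i j = R (i + 1) j := by
      intro i j
      by_contra hne
      have h1 := (Finset.sum_eq_zero_iff_of_nonneg hnn).1 h0.symm i (Finset.mem_univ _)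
      have h2 := (Finset.sum_eq_zero_iff_of_nonneg fun j _ => dis_nonneg _ _).1 h1 j
        (Finset.mem_univ _)
      rw [dis_of_ne hne] at h2
      exact one_ne_zero h2
    have hconst : ∀ (k : ℕ) i j, R (i + k) j = R i j := by
      intro k i j
      induction k with
      | zero => simp
      | succ k ih => rw [Nat.cast_succ, ← add_assoc, ← heq, ih]
    obtain ⟨i, i', j, hne⟩ := hσ
    obtain ⟨k, -, rfl⟩ := exists_eq_add_natCast i i'
    exact hne (hconst k i j).symm
  rw [hall, excess_rows, excess_rows]
  have h1 : ∑ _i : ZMod K, rowCost h (R i₀) ≤ ∑ i, rowCost h (R i) :=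
    Finset.sum_le_sum fun i hi => hi₀ i hi
  simp only [dis_self, Finset.sum_const_zero]
  linarith

/-- Every configuration that is not constant reaches a lower energy over a barrier of at most `2`. -/
theorem exists_lower (hK : 2 ≤ K) (hL : 2 ≤ L) (h : ℝ) {σ : Config K L q}
    (hσ : ∀ s, σ ≠ const s) :
    ∃ τ, excess h τ < excess h σ ∧
      JoinedIn (flipGraph K L q) {ρ | excess h ρ ≤ excess h σ + 2} σ τ := by
  by_cases hrow : ∃ i i' j, σ (i, j) ≠ σ (i', j)
  · exact exists_lower_of_rows hK h hrow
  by_cases hcol : ∃ j j' i, σ (i, j) ≠ σ (i, j')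
  · obtain ⟨τ, h1, h2⟩ := exists_lower_of_rows hL h (σ := transpose σ) hcol
    rw [excess_transpose] at h1 h2
    refine ⟨transpose τ, by rwa [excess_transpose], joinedIn_transpose (fun ρ hρ => ?_) h2⟩
    change excess h _ ≤ _
    rw [excess_transpose]
    exact hρ
  · push Not at hrow hcol
    refine absurd (funext fun v => ?_) (hσ (σ (0, 0)))
    exact (hrow v.1 0 v.2).trans (hcol v.2 0 0)

end Rows

/-! ### Stability levels and gates -/

variable {K L q : ℕ} [NeZero q]

theorem barB_nonempty (l : ℕ) (hl : 1 ≤ l) (m : Fin q) :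
    (barB (l - 1) l 1 m one : Set (Config K L q)).Nonempty :=
  ⟨mark m (rect (0, 0) (l - 1) l ∪ rect ((0, 0) + (-1, ((0 : ℕ) : ZMod L))) 1 1), _,
    ⟨(0, 0), 0, by omega, .inl rfl⟩, fun _ hv => mark_of_mem hv, fun _ hv => mark_of_notMem hv⟩

variable [NeZero K] [NeZero L]

theorem energy_le_iff {h c : ℝ} {m : Fin q} (hm : m ≠ one) {σ : Config K L q} :
    energy h σ ≤ energy h (const m : Config K L q) + c ↔ excess h σ ≤ c := by
  rw [energy_eq, energy_eq, excess_const h hm]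
  constructor <;> intro _ <;> linarith

theorem energy_eq_const_add {h : ℝ} {m : Fin q} (hm : m ≠ one) (σ : Config K L q) :
    energy h σ = energy h (const m : Config K L q) + excess h σ := by
  rw [energy_eq, energy_eq, excess_const h hm]
  ring

theorem stabilityLevel_const {h : ℝ} {l : ℕ} (hl : IsCritical h l) (hK : 3 * l ≤ K)
    (hL : 3 * l ≤ L) {m : Fin q} (hm : m ≠ one) :
    stabilityLevel (flipGraph K L q) (energy h) (const m) = (barrier h l : ℝ) := by
  have h3 := hl.three_le
  have hdrop := fun w hw => droplet (w := w) hl (by omega : l < K) (by omega : l < L) hm hw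
  refine le_antisymm ?_ (le_stabilityLevel flipGraph_preconnected fun z hz p =>
    le_height_of_separates (W := barB (l - 1) l 1 m one) (fun p hp => ?_) (fun w hw => ?_) p)
  · obtain ⟨w, hw⟩ := barB_nonempty (K := K) (L := L) l (by omega) m
    obtain ⟨hE, hj1, hj2⟩ := hdrop w hw
    refine stabilityLevel_le (z := const one) ?_ ((hj1.trans hj2).mono ?_)
    · rw [energy_eq_const_add hm (const one), excess_const_one]
      have h5 : (0 : ℝ) < h * (K * L) := mul_pos hl.pos (mul_pos
        (by exact_mod_cast (by omega : 0 < K)) (by exact_mod_cast (by omega : 0 < L)))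
      linarith
    · rintro z (rfl | hz)
      · exact (energy_le_iff hm).2 hE.le
      · exact (energy_le_iff hm).2 hz.le
  · have hp' : ∀ z ∈ p.support, excess h z ≤ barrier h l := fun z hz =>
      (energy_le_iff hm).1 (hp z hz)
    refine exists_mem_barB hl hK hL hm (fun hsub => ?_) p hp'
    have h4 := excess_nonneg_of_subcritical hl hm hsub (hp' _ p.end_mem_support)
    rw [energy_eq_const_add hm z] at hz
    linarith
  · rw [energy_eq_const_add hm w, (hdrop w hw).1]

theorem stabilityLevel_le_two (hK : 2 ≤ K) (hL : 2 ≤ L) (h : ℝ) {σ : Config K L q}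
    (hσ : ∀ s, σ ≠ const s) :
    stabilityLevel (flipGraph K L q) (energy h) σ ≤ ((2 : ℝ) : WithTop ℝ) := by
  obtain ⟨τ, h1, h2⟩ := exists_lower hK hL h hσ
  refine stabilityLevel_le (z := τ) ?_ (h2.mono fun ρ hρ => ?_)
  · rw [energy_eq, energy_eq]; linarith
  · change excess h ρ ≤ _ at hρ
    change energy h ρ ≤ _
    rw [energy_eq, energy_eq]
    linarith

theorem metastable_energy {h : ℝ} {l : ℕ} (hl : IsCritical h l) (hK : 3 * l ≤ K)
    (hL : 3 * l ≤ L) (hq : 2 < q) :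
    metastable (flipGraph K L q) (energy h) = {η | ∃ m : Fin q, m ≠ one ∧ η = const m} := by
  have h3 := hl.three_le
  have hbar : (2 : ℝ) < barrier h l := by
    have h4 : (3 : ℝ) ≤ l := by exact_mod_cast h3
    linarith [barrier_gt hl, hl.lt_one]
  have hlev := fun (m : Fin q) (hm : m ≠ one) => stabilityLevel_const (K := K) (L := L) hl hK hL hm
  have hinj : ∀ m : Fin q, m ≠ one → (const m : Config K L q) ∈ (stable (energy h))ᶜ := by
    intro m hm hst
    rw [stable_energy hl.pos] at hst
    exact hm (congrFun (Set.mem_singleton_iff.1 hst) 0)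
  have hle : ∀ σ : Config K L q, σ ∈ (stable (energy h))ᶜ →
      stabilityLevel (flipGraph K L q) (energy h) σ ≤ (barrier h l : ℝ) := by
    intro σ hσ
    by_cases hc : ∃ s, σ = const s
    · obtain ⟨s, rfl⟩ := hc
      refine (hlev s ?_).le
      rintro rfl
      exact hσ (by rw [stable_energy hl.pos]; rfl)
    · push Not at hc
      exact (stabilityLevel_le_two (by omega) (by omega) h hc).trans
        (WithTop.coe_le_coe.2 hbar.le)
  obtain ⟨m₀, hm₀⟩ : ∃ m : Fin q, m ≠ one :=
    ⟨⟨1, by omega⟩, fun h => by simpa [one] using congrArg Fin.val h⟩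
  ext η
  constructor
  · intro hη
    by_contra hcon
    have h1 : ((barrier h l : ℝ) : WithTop ℝ) ≤ stabilityLevel (flipGraph K L q) (energy h) η :=
      hlev m₀ hm₀ ▸ hη.2 ⟨_, hinj m₀ hm₀, rfl⟩
    by_cases hc : ∃ s, η = const s
    · obtain ⟨s, rfl⟩ := hc
      obtain rfl : s = one := by
        by_contra hs
        exact hcon ⟨s, hs, rfl⟩
      obtain ⟨σ, hσ, hση⟩ := hη.1
      have h2 := hle σ hσ
      have hempty : ¬(lower (energy h) (const one : Config K L q)).Nonempty := by
        rintro ⟨z, hz⟩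
        have hst : (const one : Config K L q) ∈ stable (energy h) := by
          rw [stable_energy hl.pos]; rfl
        exact absurd (hst z) (not_le.2 hz)
      rw [hση, stabilityLevel, if_neg hempty, top_le_iff] at h2
      exact WithTop.coe_ne_top h2
    · push Not at hc
      have h2 := h1.trans (stabilityLevel_le_two (by omega) (by omega) h hc)
      rw [WithTop.coe_le_coe] at h2
      linarith
  · rintro ⟨m, hm, rfl⟩
    refine ⟨⟨_, hinj m hm, rfl⟩, ?_⟩
    rintro _ ⟨σ, hσ, rfl⟩
    rw [hlev m hm]
    exact hle σ hσ

theorem gate_energy {h : ℝ} {l : ℕ} (hl : IsCritical h l) (hK : 3 * l ≤ K) (hL : 3 * l ≤ L)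
    {m : Fin q} (hm : m ≠ one) :
    IsMinimalGate (flipGraph K L q) (energy h) (const m) (const one) (barB (l - 1) l 1 m one) ∧
      gateUnion (flipGraph K L q) (energy h) (const m) (const one) =
        barB (l - 1) l 1 m one := by
  have h3 := hl.three_le
  have hdrop := fun w hw => droplet (w := w) hl (by omega : l < K) (by omega : l < L) hm hw
  refine (isMinimalGate_and_gateUnion (c := energy h (const m : Config K L q) + barrier h l)
    (barB_nonempty l (by omega) m) (fun p hp => ?_) (fun w hw => ?_) (fun w hw => ?_)).2
  · exact exists_mem_barB hl hK hL hm (const_one_notMem_subcritical hm) p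
      fun z hz => (energy_le_iff hm).1 (hp z hz)
  · rw [energy_eq_const_add hm w, (hdrop w hw).1]
  · obtain ⟨hE, ⟨p₁, hp₁⟩, ⟨p₂, hp₂⟩⟩ := hdrop w hw
    refine ⟨p₁.append p₂, ?_, fun z hz hzw => ?_⟩
    · rw [SimpleGraph.Walk.mem_support_append_iff]
      exact .inl p₁.end_mem_support
    · have hlt : excess h z < barrier h l := by
        rcases (SimpleGraph.Walk.mem_support_append_iff ..).1 hz with hz | hz
        exacts [(hp₁ z hz).resolve_left hzw, (hp₂ z hz).resolve_left hzw]
      rw [energy_eq_const_add hm z]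
      linarith

end Potts

end

theorem mainTheorem3 (K L q : ℕ) [NeZero K] [NeZero L] [NeZero q] (h : ℝ)
    (hq : 2 < q) (h_pos : 0 < h) (h_lt : h < 1) (h_int : ∀ n : ℕ, 2 / h ≠ n)
    (hK : 3 * Potts.critLen h ≤ K) (hL : 3 * Potts.critLen h ≤ L) :
    Landscape.stable (Potts.energy (K := K) (L := L) (q := q) h) = {Potts.const Potts.one} ∧
    Landscape.metastable (Potts.flipGraph K L q) (Potts.energy h) =
      {η | ∃ m : Fin q, m ≠ Potts.one ∧ η = Potts.const m} ∧
    ∀ m : Fin q, m ≠ Potts.one →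
      Landscape.IsMinimalGate (Potts.flipGraph K L q) (Potts.energy h)
        (Potts.const m) (Potts.const Potts.one)
        (Potts.barB (Potts.critLen h - 1) (Potts.critLen h) 1 m Potts.one) ∧
      Landscape.gateUnion (Potts.flipGraph K L q) (Potts.energy h)
        (Potts.const m) (Potts.const Potts.one) =
        Potts.barB (Potts.critLen h - 1) (Potts.critLen h) 1 m Potts.one := by
  have hl := Potts.isCritical_critLen h_pos h_lt h_int
  exact ⟨Potts.stable_energy h_pos, Potts.metastable_energy hl hK hL hq,
    fun m hm => Potts.gate_energy hl hK hL hm⟩
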